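/- A cone in $\mathbb{R}^2$ is a subset invariant under multiplication by all real scalars; for a cone $C$ and a set $D$ we write $D\Subset C$ if $\overline{D}\subset \mathrm{interior}(C)\cup\{0\}$. A cone system $\Theta=(C_+,C_-,\varphi_+,\varphi_-)$ consists of two closed cones $C_\pm\subset\mathbb{R}^2$ with nonempty interiors, each of dimension $1$ (the maximal dimension of a linear subspace contained in it is $1$), with $C_+\cap C_-=\{0\}$, and of a $C^\infty$ function $\varphi_+:\mathbf{S}^1\to[0,1]$ with $\varphi_+=1$ on $\mathbf{S}^1\cap C_+$ and $\varphi_+=0$ on $\mathbf{S}^1\cap C_-$, with $\varphi_-=1-\varphi_+$. Put $\Psi_{t,\Theta_\pm}(\xi)=(1+\|\xi\|^2)^{t/2}\varphi_\pm(\xi/\|\xi\|)$, let $a^{Op}\varphi=\mathbb{F}^{-1}(a\cdot\mathbb{F}\varphi)$, where $\mathbb{F}\varphi(\xi)=\int_{\mathbb{R}^2} e^{-ix\cdot\xi}\varphi(x)\,dx$, and for $t\ge 0$ let $W^{\Theta,t,0}_{2,\dagger}$ be the completion of the space $C^\infty_c(\mathbb{R}^2)$ of complex-valued compactly supported smooth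 functions for the norm $$\|\varphi\|_{W^{\Theta,t,0}_{2,\dagger}}=\|\Psi_{t,\Theta_+}^{Op}\varphi\|_{L_2(\mathbb{R}^2)}+\|\Psi_{0,\Theta_-}^{Op}\varphi\|_{L_2(\mathbb{R}^2)},$$ regarded as a subspace of $L_2(\mathbb{R}^2)$ (the norm dominates a multiple of the $L_2$ norm, and each element is identified with the $L_2$ limit of its Cauchy sequences). **Proposition A.1** (Gouëzel). Let $1_E$ be the characteristic function of a half-plane $E\subset\mathbb{R}^2$ (open or closed, bounded by any line, not necessarily through the origin). Let $F:\mathbb{R}^2\to\mathbb{R}^2$ be a linear map and $D_+,D_-$ two lines through the origin with $F(D_+)=D_+$ and $F(D_-)=D_-$. Let $\widetilde\Theta$ and $\Theta'$ be two cone systems whose cones $\widetilde C_\pm$ and $C'_\pm$ are centred on $D_\pm$, in the sense that $D_\pm\Subset\widetilde C_\pm$ and $D_\pm\Subset C'_\pm$. Then for every $t>0$ the operator $$\mathcal{E}(\varphi)=1_E\cdot(\varphi\circ F)$$ does not map $W^{\widetilde\Theta,2t,0}_{2,\dagger}$ into $W^{\Theta',2t,0}_{2,\dagger}$; that is, there is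 $\varphi\in W^{\widetilde\Theta,2t,0}_{2,\dagger}$ with $\mathcal{E}(\varphi)\notin W^{\Theta',2t,0}_{2,\dagger}$. -/

import Mathlib

open MeasureTheory Filter Topology Set
open scoped ContDiff Manifold FourierTransform ENNReal

noncomputable section

namespace AnisoSobolev

/-- The Euclidean plane `ℝ²`. -/
abbrev Plane : Type := EuclideanSpace ℝ (Fin 2)

/-- A cone is a subset that is invariant under scalar multiplication. -/
def IsCone (C : Set Plane) : Prop :=
  ∀ (c : ℝ), ∀ x ∈ C, c • x ∈ C

/-- `C ⋐ C'`: the closure of `C` is contained in `interior C' ∪ {0}`. -/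
def ConeSubset (C C' : Set Plane) : Prop :=
  closure C ⊆ interior C' ∪ {0}

/-- `C` is `k`-dimensional: `k ≥ 1` is the maximal dimension of a linear subspace inside `C`. -/
def HasConeDim (C : Set Plane) (k : ℕ) : Prop :=
  1 ≤ k ∧ IsGreatest {m : ℕ | ∃ V : Submodule ℝ Plane, Module.finrank ℝ V = m ∧ (V : Set Plane) ⊆ C} k

/-- A cone pair in the plane (with both dimensions equal to one): closed cones with nonempty
interiors, meeting only at the origin. -/
structure ConePair where
  plus : Set Plane
  minus : Set Plane
  isCone_plus : IsCone plus
  isCone_minus : IsCone minus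
  isClosed_plus : IsClosed plus
  isClosed_minus : IsClosed minus
  interior_plus : (interior plus).Nonempty
  interior_minus : (interior minus).Nonempty
  dim_plus : HasConeDim plus 1
  dim_minus : HasConeDim minus 1
  inter_eq : plus ∩ minus = {0}

/-- A cone system: a cone pair with a smooth function `φ₊ : S¹ → [0,1]` which is `1` on `C₊` and
`0` on `C₋`. -/
structure ConeSystem extends ConePair where
  phiPlus : Metric.sphere (0 : Plane) 1 → ℝ
  smooth_phiPlus : ContMDiff (𝓡 1) 𝓘(ℝ, ℝ) ∞ phiPlus
  phiPlus_mem : ∀ ξ, phiPlus ξ ∈ Icc (0 : ℝ) 1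
  phiPlus_eq_one : ∀ ξ : Metric.sphere (0 : Plane) 1, (ξ : Plane) ∈ plus → phiPlus ξ = 1
  phiPlus_eq_zero : ∀ ξ : Metric.sphere (0 : Plane) 1, (ξ : Plane) ∈ minus → phiPlus ξ = 0

/-- `φ₋ = 1 - φ₊`. -/
def ConeSystem.phiMinus (Θ : ConeSystem) (ξ : Metric.sphere (0 : Plane) 1) : ℝ :=
  1 - Θ.phiPlus ξ

/-- The direction `ξ / ‖ξ‖` of a nonzero vector, as a point of the unit circle. -/
def direction (ξ : Plane) (h : ξ ≠ 0) : Metric.sphere (0 : Plane) 1 :=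
  ⟨‖ξ‖⁻¹ • ξ, by simp [norm_smul, h]⟩

open Classical in
/-- The function `ξ ↦ (1 + ‖ξ‖²)^(t/2) φ (ξ/‖ξ‖)` for `φ` on the unit circle (the value at the
single point `ξ = 0` is irrelevant and set to `0`). -/
def coneSymbol (t : ℝ) (φ : Metric.sphere (0 : Plane) 1 → ℝ) (ξ : Plane) : ℝ :=
  if h : ξ = 0 then 0 else (1 + ‖ξ‖ ^ 2) ^ (t / 2) * φ (direction ξ h)

/-- The Fourier multiplier operator `a^{Op}`, that is
`a^{Op} φ (x) = (2π)⁻² ∫ exp(i x·η) a(η) ∫ exp(-i y·η) φ(y) dy dη`.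
The library transform is `𝓕 φ (ξ) = ∫ exp(-2π i y·ξ) φ(y) dy`, whence the substitution
`η = 2π ξ`. -/
def symbolOp (a : Plane → ℝ) (φ : Plane → ℂ) : Plane → ℂ :=
  𝓕⁻ (fun ξ : Plane => (a ((2 * Real.pi) • ξ) : ℂ) * 𝓕 φ ξ)

/-- The anisotropic norm `‖Ψ_{t,Θ₊}^{Op} φ‖_{L_p} + ‖Ψ_{v,Θ₋}^{Op} φ‖_{L_p}` of a test function. -/
def anisoNorm (Θ : ConeSystem) (p : ℝ≥0∞) (t v : ℝ) (φ : Plane → ℂ) : ℝ≥0∞ :=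
  eLpNorm (symbolOp (coneSymbol t Θ.phiPlus) φ) p volume +
    eLpNorm (symbolOp (coneSymbol v Θ.phiMinus) φ) p volume

/-- Complex-valued smooth functions with compact support. -/
def IsTestFunction (φ : Plane → ℂ) : Prop :=
  ContDiff ℝ ∞ φ ∧ HasCompactSupport φ

/-- The space `W^{Θ,t,0}_{2,†}` (for `t ≥ 0`): the completion of the test functions for
`anisoNorm Θ 2 t 0`. This norm dominates a multiple of the `L₂` norm, so a Cauchy sequence of test
functions has an `L₂` limit, and the completion is realised as the set of the `L₂` functions that
arise as such limits. -/
def anisoSpace (Θ : ConeSystem) (t : ℝ) : Set (Plane → ℂ) :=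
  {f | MemLp f 2 volume ∧ ∃ u : ℕ → Plane → ℂ,
    (∀ n, IsTestFunction (u n)) ∧
    Tendsto (fun q : ℕ × ℕ => anisoNorm Θ 2 t 0 (u q.1 - u q.2)) atTop (𝓝 0) ∧
    Tendsto (fun n => eLpNorm (u n - f) 2 volume) atTop (𝓝 0)}

/-- `E` is a half-plane, open or closed, whose boundary is any line. -/
def IsHalfPlane (E : Set Plane) : Prop :=
  ∃ (w : Plane) (c : ℝ), w ≠ 0 ∧
    (E = {x | c ≤ inner ℝ w x} ∨ E = {x | c < inner ℝ w x})

/-- The cones of the cone system `Θ` are centred on the lines `D₊` and `D₋`. Only `D₊ ⋐ C₊` and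
`D₋ ⋐ C₋` is required, no symmetry of the cones about the lines. -/
def CentredOn (Θ : ConeSystem) (Dplus Dminus : Submodule ℝ Plane) : Prop :=
  ConeSubset (Dplus : Set Plane) Θ.plus ∧ ConeSubset (Dminus : Set Plane) Θ.minus

/-- The operator `φ ↦ 1_E · (φ ∘ F)`. -/
def cutoffOp (E : Set Plane) (F : Plane →ₗ[ℝ] Plane) (φ : Plane → ℂ) : Plane → ℂ :=
  fun x => E.indicator (fun _ => (1 : ℂ)) x * φ (F x)

end AnisoSobolev

end

open scoped SchwartzMap ComplexConjugate

noncomputable section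

/-! ### Plancherel's formula for Fourier integrals. -/

section Plancherel

/-! A sharp cutoff along a line couples frequencies differing by multiples of its normal `w`, and
dilations show that no fixed decay rate survives this coupling. Let τ > 0 be the order of the spaces
(τ = 2t in the theorem), Γ the minus cone of the source and V the plus cone of the target, and
suppose that the operator maps one space into the other.

For functions with frequencies in Γ the source norm is at most the L² norm, so their L² closure lies
in the source space (`mem_anisoSpace_of_mem_closure`). An element of the target space pairs with a
function `h` with frequencies in V beyond radius R with size O(R^(-τ)) ‖h‖
(`exists_norm_integral_mul_conj_le`). Banach–Steinhaus then gives one constant C with |∫_E (u∘F) h̄|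
≤ C R^(-τ) ‖u‖ ‖h‖ (`exists_pairing_bound_of_mapsTo`).

Dilating by l preserves both cones, replaces R by lR, and scales the pairing and the product of
norms alike. Letting l → ∞, and translating the boundary at the same time, the pairing vanishes over
every half-plane parallel to E (`not_forall_norm_pairing_le`). Now take `u` with u∘F = v and let `h`
be v times a character of w·x that moves the frequencies of v into V. The pairings are the integrals
of |v|² times a unimodular function of w·x over all these half-planes, so v = 0
(`SchwartzMap.eq_zero_of_forall_halfSpace`), although v can be chosen nonzero. -/

theorem continuous_neg_innerₗ {V : Type*} [NormedAddCommGroup V] [InnerProductSpace ℝ V] :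
    Continuous fun p : V × V => (-innerₗ V : V →ₗ[ℝ] V →ₗ[ℝ] ℝ) p.1 p.2 := by
  change Continuous fun p : V × V => -inner ℝ p.1 p.2
  exact continuous_inner.neg

variable {V : Type*} [NormedAddCommGroup V] [InnerProductSpace ℝ V] [FiniteDimensional ℝ V]
  [MeasurableSpace V] [BorelSpace V]

/-- The inverse Fourier integral is self-adjoint on integrable functions. -/
theorem integral_mul_fourierInv_eq {f g : V → ℂ} (hf : Integrable f) (hg : Integrable g) :
    ∫ x, f x * 𝓕⁻ g x = ∫ x, 𝓕⁻ f x * g x := by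
  have h := VectorFourier.integral_bilin_fourierIntegral_eq_flip
    (ContinuousLinearMap.mul ℂ ℂ) (L := -innerₗ V) (μ := volume) (ν := volume)
    Real.continuous_fourierChar (continuous_neg_innerₗ) hf hg
  have hflip : (-innerₗ V : V →ₗ[ℝ] V →ₗ[ℝ] ℝ).flip = -innerₗ V := by
    ext x y; simp [real_inner_comm]
  rw [hflip] at h
  exact h.symm

/-- On integrable square integrable functions, the inverse Fourier integral agrees with the inverse
Fourier transform of `L²`. -/
theorem fourierInv_ae_eq_fourierInv_toLp {A : V → ℂ} (h1 : Integrable A) (h2 : MemLp A 2 volume) :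
    𝓕⁻ A =ᵐ[volume] (𝓕⁻ (h2.toLp A : Lp ℂ 2 (volume : Measure V)) : Lp ℂ 2 (volume : Measure V)) := by
  have hcont : Continuous (𝓕⁻ A) :=
    VectorFourier.fourierIntegral_continuous Real.continuous_fourierChar
      (L := -innerₗ V) (continuous_neg_innerₗ) h1
  -- Both sides are locally integrable, so it suffices to test against smooth compactly supported
  -- `g`; there the L² transform is the distributional one, which moves onto `g` by
  -- self-adjointness.
  refine ae_eq_of_integral_contDiff_smul_eq hcont.locallyIntegrable
    ((Lp.memLp _).locallyIntegrable (by norm_num)) fun g hg hgc => ?_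
  have hgC : HasCompactSupport (fun x => (g x : ℂ)) := hgc.comp_left (g := Complex.ofReal) rfl
  set s : 𝓢(V, ℂ) := hgC.toSchwartzMap (Complex.ofRealCLM.contDiff.comp hg) with hs
  have hsg : ∀ x, s x = (g x : ℂ) := fun x => rfl
  have key := DFunLike.congr_fun (Lp.fourierInv_toTemperedDistribution_eq (h2.toLp A)) s
  rw [TemperedDistribution.fourierInv_apply, Lp.toTemperedDistribution_apply,
    Lp.toTemperedDistribution_apply] at key
  have e1 : ∫ x, g x • 𝓕⁻ A x = ∫ x, s x * 𝓕⁻ A x := by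
    refine integral_congr_ae (ae_of_all _ fun x => ?_)
    simp [hsg]
  have e2 : ∫ x, g x • (𝓕⁻ (h2.toLp A : Lp ℂ 2 (volume : Measure V)) : Lp ℂ 2 (volume : Measure V)) x
      = ∫ x, s x • (𝓕⁻ (h2.toLp A : Lp ℂ 2 (volume : Measure V)) : Lp ℂ 2 (volume : Measure V)) x := by
    refine integral_congr_ae (ae_of_all _ fun x => ?_)
    simp [hsg]
  rw [e1, e2, ← key, integral_mul_fourierInv_eq s.integrable h1]
  refine integral_congr_ae ?_
  filter_upwards [h2.coeFn_toLp] with x hx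
  rw [hx, SchwartzMap.fourierInv_coe, smul_eq_mul]

/-- Plancherel's formula for integrable square integrable functions. -/
theorem eLpNorm_fourierInv_eq {A : V → ℂ} (h1 : Integrable A) (h2 : MemLp A 2 volume) :
    eLpNorm (𝓕⁻ A) 2 volume = eLpNorm A 2 volume := by
  rw [eLpNorm_congr_ae (fourierInv_ae_eq_fourierInv_toLp h1 h2), ← Lp.enorm_def,
    ← eLpNorm_congr_ae h2.coeFn_toLp, ← Lp.enorm_def]
  have : ‖(𝓕⁻ (h2.toLp A : Lp ℂ 2 (volume : Measure V)) : Lp ℂ 2 (volume : Measure V))‖ = ‖h2.toLp A‖ :=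
    (Lp.fourierTransformₗᵢ V ℂ).symm.norm_map _
  rw [← ofReal_norm, ← ofReal_norm, this]

theorem SchwartzMap.eLpNorm_fourier_eq (f : 𝓢(V, ℂ)) :
    eLpNorm (𝓕 f : 𝓢(V, ℂ)) 2 volume = eLpNorm f 2 volume := by
  have h := eLpNorm_fourierInv_eq (𝓕 f).integrable ((𝓕 f).memLp 2)
  rw [← h, ← SchwartzMap.fourierInv_coe, FourierTransform.fourierInv_fourier_eq]

end Plancherel

/-! ### Density of compactly supported functions in the Schwartz space. -/

section Cutoff

variable {V : Type*} [NormedAddCommGroup V] [InnerProductSpace ℝ V] [FiniteDimensional ℝ V]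

/-- Compactly supported smooth functions are dense in the Schwartz space. -/
theorem SchwartzMap.exists_tendsto_hasCompactSupport (s : 𝓢(V, ℂ)) :
    ∃ v : ℕ → 𝓢(V, ℂ), (∀ n, HasCompactSupport (v n)) ∧ Tendsto v atTop (𝓝 s) := by
  obtain ⟨χ⟩ : Nonempty (ContDiffBump (0 : V)) := inferInstance
  let r : ℕ → ℝ := fun n => ((n : ℝ) + 1)⁻¹
  have hr0 : ∀ n, 0 < r n := fun n => by positivity
  have hr1 : ∀ n, r n ≤ 1 := fun n => inv_le_one_of_one_le₀ (by simp)
  have hχc : ∀ n, HasCompactSupport fun x : V => (χ (r n • x) : ℂ) := fun n =>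
    (χ.hasCompactSupport.comp_smul (hr0 n).ne').comp_left (g := Complex.ofReal) rfl
  have hχs : ContDiff ℝ ∞ fun x : V => (χ x : ℂ) := Complex.ofRealCLM.contDiff.comp χ.contDiff
  let c : V → ℂ := fun x => 1 - χ x
  have hc : ContDiff ℝ ∞ c := contDiff_const.sub hχs
  have hdil : ∀ n, ContDiff ℝ ∞ fun x : V => r n • x := fun n => contDiff_const_smul _
  have hcbound : ∀ i : ℕ, ∃ C, ∀ x, ‖iteratedFDeriv ℝ i c x‖ ≤ C := by
    intro i
    have hcs : HasCompactSupport fun x : V => (χ x : ℂ) :=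
      χ.hasCompactSupport.comp_left (g := Complex.ofReal) rfl
    obtain ⟨C, hC⟩ := (hcs.iteratedFDeriv (𝕜 := ℝ) i).exists_bound_of_continuous
      (hχs.continuous_iteratedFDeriv (by exact_mod_cast le_top))
    refine ⟨1 + C, fun x => ?_⟩
    have hsub : iteratedFDeriv ℝ i c x
        = iteratedFDeriv ℝ i (fun _ : V => (1 : ℂ)) x
          - iteratedFDeriv ℝ i (fun x : V => (χ x : ℂ)) x :=
      iteratedFDeriv_sub_apply (contDiff_const.contDiffAt)
        ((hχs.of_le (by exact_mod_cast le_top)).contDiffAt)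
    have hone : ‖iteratedFDeriv ℝ i (fun _ : V => (1 : ℂ)) x‖ ≤ 1 := by
      rcases Nat.eq_zero_or_pos i with rfl | hi
      · simp
      · rw [iteratedFDeriv_const_of_ne hi.ne']; simp
    rw [hsub]
    exact (norm_sub_le _ _).trans (add_le_add hone (hC x))
  choose! K hK using hcbound
  have hK0 : ∀ i, 0 ≤ K i := fun i => (norm_nonneg _).trans (hK i 0)
  have hcn : ∀ (n i : ℕ) (x : V), ‖iteratedFDeriv ℝ i (fun y => c (r n • y)) x‖ ≤ K i := by
    intro n i x
    have h := (r n • ContinuousLinearMap.id ℝ V).iteratedFDeriv_comp_right hc x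
      (i := i) (by exact_mod_cast le_top)
    have h' : (c ∘ (r n • ContinuousLinearMap.id ℝ V)) = fun y => c (r n • y) := rfl
    rw [h'] at h
    rw [h]
    refine (ContinuousMultilinearMap.norm_compContinuousLinearMap_le _ _).trans ?_
    have hn : ‖r n • ContinuousLinearMap.id ℝ V‖ ≤ 1 := by
      rw [norm_smul, Real.norm_of_nonneg (hr0 n).le]
      exact mul_le_one₀ (hr1 n) (norm_nonneg _) ContinuousLinearMap.norm_id_le
    calc _ ≤ K i * 1 := by
          refine mul_le_mul (hK i _) ?_ (by positivity) (hK0 i)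
          exact Finset.prod_le_one (fun _ _ => norm_nonneg _) fun _ _ => hn
      _ = K i := mul_one _
  have hc0 : ∀ (n i : ℕ) (x : V), r n * ‖x‖ < χ.rIn →
      iteratedFDeriv ℝ i (fun y => c (r n • y)) x = 0 := by
    intro n i x hx
    have h : (fun y => c (r n • y)) =ᶠ[𝓝 x] fun _ => 0 := by
      have hopen : ∀ᶠ y : V in 𝓝 x, r n * ‖y‖ < χ.rIn :=
        (continuous_const.mul continuous_norm).continuousAt.eventually_lt_const hx
      filter_upwards [hopen] with y hy
      have : χ (r n • y) = 1 := χ.one_of_mem_closedBall (by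
        rw [mem_closedBall_zero_iff, norm_smul, Real.norm_of_nonneg (hr0 n).le]; exact hy.le)
      simp [c, this]
    rw [(Filter.EventuallyEq.iteratedFDeriv ℝ h i).eq_of_nhds]
    simp
  let v : ℕ → 𝓢(V, ℂ) := fun n =>
    ((hχc n).mul_right (f' := s)).toSchwartzMap ((hχs.comp (hdil n)).mul (s.smooth ⊤))
  refine ⟨v, fun n => (hχc n).mul_right, ?_⟩
  rw [(schwartz_withSeminorms ℝ V ℂ).tendsto_nhds]
  rintro ⟨k, m⟩ ε hε
  -- All derivatives of 1 - χ(r x) vanish where r‖x‖ < `χ.rIn`. Elsewhere 1 ≤ r‖x‖ / `χ.rIn`, so one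
  -- extra power of ‖x‖, absorbed by the seminorm of index k + 1, buys the factor r → 0.
  let B : ℝ := ∑ i ∈ Finset.range (m + 1),
    (m.choose i : ℝ) * K i * (χ.rIn⁻¹ * SchwartzMap.seminorm ℝ (k + 1) (m - i) s)
  have hbound : ∀ n, SchwartzMap.seminorm ℝ k m (v n - s) ≤ r n * B := by
    intro n
    have hB : 0 ≤ B := Finset.sum_nonneg fun i _ => by
      have := hK0 i
      have := χ.rIn_pos
      positivity
    refine SchwartzMap.seminorm_le_bound ℝ k m _ (mul_nonneg (hr0 n).le hB) fun x => ?_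
    have hfun : ((v n - s : 𝓢(V, ℂ)) : V → ℂ) = -(fun y => c (r n • y) * s y) := by
      funext y
      change (χ (r n • y) : ℂ) * s y - s y = -((1 - (χ (r n • y) : ℂ)) * s y)
      ring
    rw [hfun, iteratedFDeriv_neg_apply, norm_neg]
    calc ‖x‖ ^ k * ‖iteratedFDeriv ℝ m (fun y => c (r n • y) * s y) x‖
        ≤ ‖x‖ ^ k * ∑ i ∈ Finset.range (m + 1), (m.choose i : ℝ)
            * ‖iteratedFDeriv ℝ i (fun y => c (r n • y)) x‖ * ‖iteratedFDeriv ℝ (m - i) s x‖ := by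
          gcongr
          exact norm_iteratedFDeriv_mul_le (hc.comp (hdil n)) (s.smooth ⊤) x
            (by exact_mod_cast le_top)
      _ ≤ r n * B := by
          rw [Finset.mul_sum, Finset.mul_sum]
          refine Finset.sum_le_sum fun i _ => ?_
          rcases lt_or_ge (r n * ‖x‖) χ.rIn with hx | hx
          · rw [hc0 n i x hx]
            have := hK0 i
            have := χ.rIn_pos
            have := hr0 n
            simp only [norm_zero, mul_zero, zero_mul]
            positivity
          · have h1 : 1 ≤ r n * ‖x‖ * χ.rIn⁻¹ := by
              rwa [← div_eq_mul_inv, one_le_div χ.rIn_pos]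
            have h2 := s.le_seminorm ℝ (k + 1) (m - i) x
            have h3 := hcn n i x
            have := hK0 i
            have := hr0 n
            have := χ.rIn_pos
            calc ‖x‖ ^ k * ((m.choose i : ℝ) * ‖iteratedFDeriv ℝ i (fun y => c (r n • y)) x‖
                  * ‖iteratedFDeriv ℝ (m - i) s x‖)
                ≤ ‖x‖ ^ k * ((m.choose i : ℝ) * K i * ‖iteratedFDeriv ℝ (m - i) s x‖) * 1 := by
                  rw [mul_one]; gcongr
              _ ≤ ‖x‖ ^ k * ((m.choose i : ℝ) * K i * ‖iteratedFDeriv ℝ (m - i) s x‖)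
                    * (r n * ‖x‖ * χ.rIn⁻¹) := by gcongr
              _ = r n * ((m.choose i : ℝ) * K i * (χ.rIn⁻¹
                    * (‖x‖ ^ (k + 1) * ‖iteratedFDeriv ℝ (m - i) s x‖))) := by ring
              _ ≤ _ := by gcongr
  have hlim : Tendsto (fun n => r n * B) atTop (𝓝 0) := by
    have : Tendsto r atTop (𝓝 0) := by
      simpa [r] using tendsto_one_div_add_atTop_nhds_zero_nat (𝕜 := ℝ)
    simpa using this.mul_const B
  filter_upwards [hlim.eventually (gt_mem_nhds hε)] with n hn
  exact (hbound n).trans_lt hn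

end Cutoff

/-! ### Affine changes of variables and the Fourier transform. -/

section ChangeOfVariables

variable {V : Type*} [NormedAddCommGroup V] [InnerProductSpace ℝ V]

/-- The Schwartz function `x ↦ u (A x + b)`. -/
def SchwartzMap.compAffine (A : V ≃L[ℝ] V) (b : V) (u : 𝓢(V, ℂ)) : 𝓢(V, ℂ) :=
  SchwartzMap.compCLMOfContinuousLinearEquiv ℂ A (SchwartzMap.compSubConstCLM ℂ (-b) u)

theorem SchwartzMap.compAffine_apply (A : V ≃L[ℝ] V) (b : V) (u : 𝓢(V, ℂ)) (x : V) :
    u.compAffine A b x = u (A x + b) := by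
  simp [SchwartzMap.compAffine]

variable [FiniteDimensional ℝ V] [MeasurableSpace V] [BorelSpace V]

theorem integral_comp_affine {F : Type*} [NormedAddCommGroup F] [NormedSpace ℝ F]
    (A : V ≃L[ℝ] V) (b : V) (G : V → F) :
    ∫ x, G (A x + b) = |(LinearMap.det (A : V →ₗ[ℝ] V))⁻¹| • ∫ y, G y := by
  have hdet : LinearMap.det (A : V →ₗ[ℝ] V) ≠ 0 := (LinearEquiv.isUnit_det' A.toLinearEquiv).ne_zero
  have h1 : ∫ x, G (A x + b) = ∫ y, G (y + b) ∂(Measure.map A volume) :=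
    (A.toHomeomorph.measurableEmbedding.integral_map (fun y => G (y + b))).symm
  have h2 := Measure.map_linearMap_addHaar_eq_smul_addHaar (volume : Measure V) hdet
  have h3 : Measure.map A (volume : Measure V) = Measure.map (A : V →ₗ[ℝ] V) volume := rfl
  rw [h1, h3, h2, integral_smul_measure, ENNReal.toReal_ofReal (abs_nonneg _),
    integral_add_right_eq_self]

/-- The transform of the composite is a phase and a Jacobian times the transform of `u` at the
transposed inverse point. Only frequency supports matter later, so both factors are left out of the
statement. -/
theorem SchwartzMap.fourier_compAffine_eq_zero (A : V ≃L[ℝ] V) (b : V) (u : 𝓢(V, ℂ)) (ξ : V)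
    (h : 𝓕 u (ContinuousLinearMap.adjoint (A.symm : V →L[ℝ] V) ξ) = 0) :
    𝓕 (u.compAffine A b) ξ = 0 := by
  set η := ContinuousLinearMap.adjoint (A.symm : V →L[ℝ] V) ξ with hη
  rw [SchwartzMap.fourier_coe, Real.fourier_eq] at h ⊢
  have hG : ∀ x, Real.fourierChar (-inner ℝ x ξ) • u.compAffine A b x
      = (fun y => Real.fourierChar (-inner ℝ (A.symm (y - b)) ξ) • u y) (A x + b) := by
    intro x
    simp [SchwartzMap.compAffine_apply]
  refine (integral_congr_ae (ae_of_all _ hG)).trans ((integral_comp_affine A b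
    fun y => Real.fourierChar (-inner ℝ (A.symm (y - b)) ξ) • u y).trans ?_)
  have hG' : ∀ y, Real.fourierChar (-inner ℝ (A.symm (y - b)) ξ) • u y
      = Real.fourierChar (inner ℝ b η) • (Real.fourierChar (-inner ℝ y η) • u y) := by
    intro y
    rw [smul_smul, ← AddChar.map_add_eq_mul]
    have : ∀ z, inner ℝ z η = inner ℝ (A.symm z) ξ := fun z => by
      rw [hη, ContinuousLinearMap.adjoint_inner_right]; rfl
    rw [this, this, map_sub, inner_sub_left]
    congr 2
    ring
  simp only [hG', Circle.smul_def] at h ⊢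
  rw [integral_smul, h, smul_zero, smul_zero]

theorem SchwartzMap.fourierInv_compSubConst (a : 𝓢(V, ℂ)) (b x : V) :
    𝓕⁻ (SchwartzMap.compSubConstCLM ℂ b a) x = Real.fourierChar (inner ℝ b x) • 𝓕⁻ a x := by
  rw [SchwartzMap.fourierInv_coe, SchwartzMap.fourierInv_coe, Real.fourierInv_eq,
    Real.fourierInv_eq, Circle.smul_def, ← integral_smul, ← integral_add_right_eq_self _ b]
  refine integral_congr_ae (ae_of_all _ fun y => ?_)
  simp only [SchwartzMap.compSubConstCLM_apply, add_sub_cancel_right, inner_add_left]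
  rw [← Circle.smul_def, smul_smul, ← AddChar.map_add_eq_mul, add_comm]

/-- Two such square roots multiply to the Jacobian of a pairing, which is why the pairing estimate
is invariant under affine substitutions. -/
theorem SchwartzMap.norm_toLp_compAffine (A : V ≃L[ℝ] V) (b : V) (u : 𝓢(V, ℂ)) :
    ‖(u.compAffine A b).toLp 2‖ =
      |(LinearMap.det (A : V →ₗ[ℝ] V))⁻¹| ^ (2⁻¹ : ℝ) * ‖u.toLp 2‖ := by
  have h := integral_comp_affine A b (fun y => ‖u y‖ ^ (2 : ℝ))
  have h' : ∫ x, ‖u.compAffine A b x‖ ^ (2 : ℝ)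
      = |(LinearMap.det (A : V →ₗ[ℝ] V))⁻¹| * ∫ y, ‖u y‖ ^ (2 : ℝ) := by
    simp_rw [SchwartzMap.compAffine_apply]
    exact h
  rw [SchwartzMap.norm_toLp' (by simp) (by simp), SchwartzMap.norm_toLp' (by simp) (by simp)]
  simp only [ENNReal.toReal_ofNat]
  rw [h', Real.mul_rpow (abs_nonneg _) (integral_nonneg fun _ => by positivity)]

end ChangeOfVariables

/-! ### Measures tested on half-lines and half-spaces. -/

section HalfLines

/-- A finite measure on the line for which a unimodular function has vanishing integral over all
half-lines of one type is zero. -/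
theorem measure_eq_zero_of_forall_halfLine {μ : Measure ℝ} [IsFiniteMeasure μ] {g : ℝ → ℂ}
    (hg : Measurable g) (hg1 : ∀ x, ‖g x‖ = 1) {S : Set ℝ} (hS : S = Ici 0 ∨ S = Ioi 0)
    (h : ∀ c : ℝ, ∫ x in {x | x - c ∈ S}, g x ∂μ = 0) : μ = 0 := by
  have hint : Integrable g μ :=
    Integrable.of_bound hg.aestronglyMeasurable 1 (ae_of_all _ fun x => (hg1 x).le)
  have hgen : (inferInstance : MeasurableSpace ℝ)
      = MeasurableSpace.generateFrom (range fun c : ℝ => {x | x - c ∈ S}) ∧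
      IsPiSystem (range fun c : ℝ => {x | x - c ∈ S}) := by
    rcases hS with rfl | rfl
    · have : (fun c : ℝ => {x | x - c ∈ Ici (0 : ℝ)}) = Ici := by ext; simp
      rw [this]
      exact ⟨BorelSpace.measurable_eq.trans (borel_eq_generateFrom_Ici ℝ), isPiSystem_Ici⟩
    · have : (fun c : ℝ => {x | x - c ∈ Ioi (0 : ℝ)}) = Ioi := by ext; simp
      rw [this]
      exact ⟨BorelSpace.measurable_eq.trans (borel_eq_generateFrom_Ioi ℝ), isPiSystem_Ioi⟩
  -- The half-lines form a generating π-system, but the complement step of the induction also needs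
  -- the integral over the whole line, obtained as a limit of growing half-lines.
  have huniv : ∫ x, g x ∂μ = 0 := by
    have hmono : Monotone fun n : ℕ => {x : ℝ | x - (-(n : ℝ)) ∈ S} := by
      intro m n hmn x hx
      have : (m : ℝ) ≤ n := by exact_mod_cast hmn
      rcases hS with rfl | rfl <;> simp at hx ⊢ <;> linarith
    have hm : ∀ n : ℕ, MeasurableSet {x : ℝ | x - (-(n : ℝ)) ∈ S} := fun n => by
      have : MeasurableSet S := by
        rcases hS with rfl | rfl <;> measurability
      exact (measurable_id.sub_const _) this
    have hU : ⋃ n : ℕ, {x : ℝ | x - (-(n : ℝ)) ∈ S} = univ := by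
      refine eq_univ_of_forall fun x => ?_
      obtain ⟨n, hn⟩ := exists_nat_gt (-x)
      refine mem_iUnion.2 ⟨n, ?_⟩
      rcases hS with rfl | rfl <;> simp <;> linarith
    have hlim := tendsto_setIntegral_of_monotone hm hmono (f := g) (μ := μ) hint.integrableOn
    rw [hU, Measure.restrict_univ] at hlim
    refine tendsto_nhds_unique hlim ?_
    simp_rw [h]
    exact tendsto_const_nhds
  have hall : ∀ s, MeasurableSet s → ∫ x in s, g x ∂μ = 0 := by
    refine MeasurableSpace.induction_on_inter hgen.1 hgen.2 (by simp) ?_ ?_ ?_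
    · rintro _ ⟨c, rfl⟩
      exact h c
    · intro s hs ih
      have := integral_add_compl hs hint
      rwa [ih, zero_add, huniv] at this
    · intro f hd hf ih
      rw [integral_iUnion hf hd hint.integrableOn]
      simp [ih]
  have hzero : g =ᵐ[μ] 0 :=
    hint.ae_eq_zero_of_forall_setIntegral_eq_zero fun s hs _ => hall s hs
  have : ∀ᵐ _ ∂μ, False := by
    filter_upwards [hzero] with x hx
    have := hg1 x
    rw [hx] at this
    simp at this
  exact ae_eq_bot.1 (eventually_false_iff_eq_bot.1 this)

variable {V : Type*} [NormedAddCommGroup V] [InnerProductSpace ℝ V] [FiniteDimensional ℝ V]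
  [MeasurableSpace V] [BorelSpace V]

/-- The integrand is |v|² times a unimodular function of w·x. Pushing the finite measure |v|² dx
forward under x ↦ w·x turns half-spaces into half-lines, so that measure is zero. -/
theorem SchwartzMap.eq_zero_of_forall_halfSpace (v : 𝓢(V, ℂ)) (w : V) (r : ℝ) {S : Set ℝ}
    (hS : S = Ici 0 ∨ S = Ioi 0)
    (h : ∀ c : ℝ, ∫ x in {x | inner ℝ w x - c ∈ S},
      v x * conj (Real.fourierChar (r * inner ℝ w x) • v x) = 0) : v = 0 := by
  have hSm : MeasurableSet S := by
    rcases hS with rfl | rfl <;> measurability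
  let ρ : V → ℝ≥0∞ := fun x => ‖v x‖ₑ ^ 2
  have hρ : Measurable ρ := v.continuous.enorm.measurable.pow_const 2
  let ν : Measure V := volume.withDensity ρ
  have hνfin : IsFiniteMeasure ν := by
    refine isFiniteMeasure_withDensity ?_
    have := (v.memLp 2 volume).eLpNorm_lt_top
    rw [eLpNorm_lt_top_iff_lintegral_rpow_enorm_lt_top (by simp) (by simp)] at this
    simpa [ρ] using this.ne
  let T : V → ℝ := fun x => inner ℝ w x
  have hT : Measurable T := (continuous_const.inner continuous_id).measurable
  let g : ℝ → ℂ := fun τ => conj (Real.fourierChar (r * τ) : ℂ)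
  have hgm : Measurable g := by
    have : Continuous g := by
      refine Complex.continuous_conj.comp (continuous_subtype_val.comp
        (Real.continuous_fourierChar.comp (by fun_prop)))
    exact this.measurable
  have hμ := measure_eq_zero_of_forall_halfLine (μ := ν.map T) hgm (fun x => by
    simp only [g, RCLike.norm_conj, Circle.norm_coe]) hS (by
    intro c
    have hs : MeasurableSet {x : ℝ | x - c ∈ S} := (measurable_id.sub_const c) hSm
    rw [setIntegral_map hs hgm.aestronglyMeasurable hT.aemeasurable]
    have hs' : MeasurableSet (T ⁻¹' {x : ℝ | x - c ∈ S}) := hT hs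
    rw [restrict_withDensity hs', integral_withDensity_eq_integral_toReal_smul hρ
      (ae_of_all _ fun x => by simp [ρ])]
    rw [← h c]
    refine integral_congr_ae (ae_of_all _ fun x => ?_)
    simp only [ρ, g, T, ENNReal.toReal_pow, toReal_enorm, Circle.smul_def, smul_eq_mul, map_mul]
    rw [Complex.real_smul]
    have := Complex.mul_conj' (v x)
    push_cast
    rw [← this]
    ring)
  have hν : ν = 0 := (Measure.map_eq_zero_iff hT.aemeasurable).1 hμ
  have hae : ρ =ᵐ[volume] 0 := (withDensity_eq_zero_iff hρ.aemeasurable).1 hν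
  have : (v : V → ℂ) =ᵐ[volume] (0 : 𝓢(V, ℂ)) := by
    filter_upwards [hae] with x hx
    simpa [ρ] using hx
  exact DFunLike.coe_injective ((Continuous.ae_eq_iff_eq volume v.continuous
    (0 : 𝓢(V, ℂ)).continuous).1 this)

end HalfLines

namespace AnisoSobolev

/-! ### The scaling argument for half-plane pairings. -/

/-- Modulo the line ℝw the plane is one-dimensional, with coordinate `f`. Open sets contain points
with `f` nonzero, and homogeneity of U₂ allows its point to be rescaled until the two coordinates
agree. -/
theorem exists_translate_mem {U₁ U₂ : Set Plane} (h₁ : IsOpen U₁) (h₁' : U₁.Nonempty)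
    (h₂ : IsOpen U₂) (h₂' : U₂.Nonempty) (hcone : ∀ c : ℝ, c ≠ 0 → ∀ x ∈ U₂, c • x ∈ U₂)
    {w : Plane} (hw : w ≠ 0) : ∃ (p : Plane) (s : ℝ), p ∈ U₁ ∧ p + s • w ∈ U₂ ∧ p + s • w ≠ 0 := by
  let f : Plane →ₗ[ℝ] ℝ :=
    { toFun := fun x => w 0 * x 1 - w 1 * x 0
      map_add' := fun x y => by simp; ring
      map_smul' := fun c x => by simp; ring }
  have hf : ∀ x, f x = w 0 * x 1 - w 1 * x 0 := fun _ => rfl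
  have hw' : w 0 ≠ 0 ∨ w 1 ≠ 0 := by
    by_contra! h
    exact hw (by ext i; fin_cases i <;> simp [h.1, h.2])
  have hker : ∀ x, f x = 0 → ∃ s : ℝ, x = s • w := by
    intro x hx
    rw [hf] at hx
    rcases hw' with h | h
    · refine ⟨x 0 / w 0, ?_⟩
      ext i; fin_cases i
      · simp; field_simp
      · simp; field_simp; linarith
    · refine ⟨x 1 / w 1, ?_⟩
      ext i; fin_cases i
      · simp; field_simp; linarith
      · simp; field_simp
  have hne : LinearMap.ker f ≠ ⊤ := by
    intro h
    have h0 : ∀ x, f x = 0 := fun x => by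
      have : x ∈ LinearMap.ker f := h ▸ Submodule.mem_top
      simpa using this
    have e0 := h0 (!₂[1, 0])
    have e1 := h0 (!₂[0, 1])
    simp [hf] at e0 e1
    rcases hw' with h | h <;> contradiction
  have hex : ∀ U : Set Plane, IsOpen U → U.Nonempty → ∃ x ∈ U, f x ≠ 0 := by
    intro U hU hU'
    by_contra! h
    have hsub : U ⊆ (LinearMap.ker f : Set Plane) := fun x hx => h x hx
    exact hne (Submodule.eq_top_of_nonempty_interior' _ (hU'.mono (interior_maximal hsub hU)))
  obtain ⟨p, hp, hfp⟩ := hex U₁ h₁ h₁'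
  obtain ⟨q, hq, hfq⟩ := hex U₂ h₂ h₂'
  obtain ⟨s, hs⟩ := hker ((f p / f q) • q - p) (by
    rw [map_sub, map_smul, smul_eq_mul]; field_simp; ring)
  have hpq : p + s • w = (f p / f q) • q := by rw [← hs]; abel
  have hc : f p / f q ≠ 0 := div_ne_zero hfp hfq
  refine ⟨p, s, hp, hpq ▸ hcone _ hc q hq, hpq ▸ smul_ne_zero hc ?_⟩
  rintro rfl
  simp at hfq

open scoped Pointwise in
theorem IsCone.smul_mem_interior {C : Set Plane} (hC : IsCone C) {c : ℝ} (hc : c ≠ 0) {x : Plane}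
    (hx : x ∈ interior C) : c • x ∈ interior C := by
  have h : c • interior C ⊆ interior C := by
    rw [← interior_smul₀ hc]
    refine interior_mono ?_
    rintro _ ⟨y, hy, rfl⟩
    exact hC c y hy
  exact h (smul_mem_smul_set hx)

/-- A half-space cutoff does not gain decay between two frequency cones. -/
theorem not_forall_norm_pairing_le {Γ V : Set Plane} (hΓ : IsCone Γ) (hV : IsCone V)
    (hΓi : (interior Γ).Nonempty) (hVi : (interior V).Nonempty) (F : Plane ≃L[ℝ] Plane)
    {w : Plane} (hw : w ≠ 0) {S : Set ℝ} (hS : S = Ici 0 ∨ S = Ioi 0) (c₀ : ℝ) {t : ℝ} (ht : 0 < t)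
    (C : ℝ) (H : ∀ R : ℝ, 0 < R → ∀ u h : 𝓢(Plane, ℂ), (∀ ξ, ξ ∉ Γ → 𝓕 u ξ = 0) →
      (∀ ξ, 𝓕 h ξ ≠ 0 → ξ ∈ V ∧ R ≤ ‖ξ‖) →
      ‖∫ x in {x | inner ℝ w x - c₀ ∈ S}, u (F x) * conj (h x)‖
        ≤ C * R ^ (-t) * (‖u.toLp 2‖ * ‖h.toLp 2‖)) : False := by
  have hSm : MeasurableSet S := by
    rcases hS with rfl | rfl <;> measurability
  have hSs : ∀ l : ℝ, 0 < l → ∀ x, l * x ∈ S ↔ x ∈ S := by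
    intro l hl x
    rcases hS with rfl | rfl
    · exact mul_nonneg_iff_of_pos_left hl
    · exact mul_pos_iff_of_pos_left hl
  have hEm : ∀ c : ℝ, MeasurableSet {x : Plane | inner ℝ w x - c ∈ S} := fun c =>
    ((continuous_const.inner continuous_id).sub continuous_const).measurable hSm
  have key : ∀ r : ℝ, 0 < r → ∀ u h : 𝓢(Plane, ℂ), (∀ ξ, ξ ∉ Γ → 𝓕 u ξ = 0) →
      (∀ ξ, 𝓕 h ξ ≠ 0 → ξ ∈ V ∧ r ≤ ‖ξ‖) → ∀ c : ℝ,
      ∫ x in {x | inner ℝ w x - c ∈ S}, u (F x) * conj (h x) = 0 := by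
    intro r hr u h hu hh c
    set I := ∫ x in {x | inner ℝ w x - c ∈ S}, u (F x) * conj (h x) with hI
    have hbound : ∀ l : ℝ, 0 < l → ‖I‖ ≤ C * (l * r) ^ (-t) * (‖u.toLp 2‖ * ‖h.toLp 2‖) := by
      intro l hl
      let A : Plane ≃L[ℝ] Plane := ContinuousLinearEquiv.smulLeft (Units.mk0 l hl.ne')
      have hA : ∀ x, A x = l • x := fun _ => rfl
      have hAs : ∀ x, A.symm x = l⁻¹ • x := fun x => by
        rw [A.symm_apply_eq, hA, smul_smul, mul_inv_cancel₀ hl.ne', one_smul]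
      have hadj : ∀ ξ, ContinuousLinearMap.adjoint (A.symm : Plane →L[ℝ] Plane) ξ = l⁻¹ • ξ := by
        intro ξ
        refine ext_inner_left ℝ fun z => ?_
        rw [ContinuousLinearMap.adjoint_inner_right, inner_smul_right]
        change inner ℝ (A.symm z) ξ = _
        rw [hAs, real_inner_smul_left]
      -- Chosen so that x ↦ l x + y carries the half-plane at level `c₀` onto the one at level `c`.
      -- Since F commutes with dilations, `u` must be translated by F y when `h` is translated by y.
      let y : Plane := ((c - l * c₀) / ‖w‖ ^ 2) • w
      have hwy : inner ℝ w y = c - l * c₀ := by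
        have : ‖w‖ ≠ 0 := norm_ne_zero_iff.2 hw
        rw [inner_smul_right, real_inner_self_eq_norm_sq]
        field_simp
      have hb := H (l * r) (mul_pos hl hr) (u.compAffine A (F y)) (h.compAffine A y)
        (fun ξ hξ => SchwartzMap.fourier_compAffine_eq_zero A _ u ξ (by
          rw [hadj]
          refine hu _ fun hmem => hξ ?_
          have := hΓ l _ hmem
          rwa [smul_smul, mul_inv_cancel₀ hl.ne', one_smul] at this))
        (fun ξ hξ => by
          have hne : 𝓕 h (l⁻¹ • ξ) ≠ 0 := fun h0 =>
            hξ (SchwartzMap.fourier_compAffine_eq_zero A _ h ξ (by rwa [hadj]))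
          obtain ⟨h1, h2⟩ := hh _ hne
          constructor
          · have := hV l _ h1
            rwa [smul_smul, mul_inv_cancel₀ hl.ne', one_smul] at this
          · rw [norm_smul, norm_inv, Real.norm_of_nonneg hl.le] at h2
            rwa [← le_inv_mul_iff₀ hl])
      set d : ℝ := |(LinearMap.det (A : Plane →ₗ[ℝ] Plane))⁻¹| with hd
      have hdpos : 0 < d := abs_pos.2 (inv_ne_zero (LinearEquiv.isUnit_det' A.toLinearEquiv).ne_zero)
      have hint : ∫ x in {x | inner ℝ w x - c₀ ∈ S},
          u.compAffine A (F y) (F x) * conj (h.compAffine A y x) = d • I := by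
        rw [hI, ← integral_indicator (hEm c), ← integral_comp_affine A y,
          ← integral_indicator (hEm c₀)]
        refine integral_congr_ae (ae_of_all _ fun x => ?_)
        have hiff : A x + y ∈ {x : Plane | inner ℝ w x - c ∈ S}
            ↔ x ∈ {x : Plane | inner ℝ w x - c₀ ∈ S} := by
          simp only [mem_ofPred_eq]
          rw [hA, inner_add_right, inner_smul_right, hwy, ← hSs l hl (inner ℝ w x - c₀)]
          ring_nf
        have hval : u.compAffine A (F y) (F x) * conj (h.compAffine A y x)
            = u (F (A x + y)) * conj (h (A x + y)) := by
          rw [SchwartzMap.compAffine_apply, SchwartzMap.compAffine_apply, F.map_add, hA, hA,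
            map_smul F l x]
        beta_reduce
        by_cases hx : x ∈ {x : Plane | inner ℝ w x - c₀ ∈ S}
        · rw [indicator_of_mem hx, indicator_of_mem (hiff.2 hx), hval]
        · rw [indicator_of_notMem hx, indicator_of_notMem (fun h' => hx (hiff.1 h'))]
      rw [hint, norm_smul, Real.norm_of_nonneg hdpos.le, SchwartzMap.norm_toLp_compAffine,
        SchwartzMap.norm_toLp_compAffine, ← hd] at hb
      have hdd : d ^ (2⁻¹ : ℝ) * d ^ (2⁻¹ : ℝ) = d := by
        rw [← Real.rpow_add hdpos]; norm_num
      refine le_of_mul_le_mul_left (hb.trans_eq ?_) hdpos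
      calc _ = C * (l * r) ^ (-t) * ((d ^ (2⁻¹ : ℝ) * d ^ (2⁻¹ : ℝ))
            * (‖u.toLp 2‖ * ‖h.toLp 2‖)) := by ring
        _ = _ := by rw [hdd]; ring
    have hlim : Tendsto (fun l : ℝ => C * (l * r) ^ (-t) * (‖u.toLp 2‖ * ‖h.toLp 2‖)) atTop
        (𝓝 (C * 0 * (‖u.toLp 2‖ * ‖h.toLp 2‖))) :=
      (((tendsto_rpow_neg_atTop ht).comp (tendsto_id.atTop_mul_const hr)).const_mul C).mul_const _
    have h0 : ‖I‖ ≤ C * 0 * (‖u.toLp 2‖ * ‖h.toLp 2‖) :=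
      ge_of_tendsto hlim ((eventually_gt_atTop 0).mono hbound)
    exact norm_le_zero_iff.1 (by simpa using h0)
  have hadj : ∀ ξ, ContinuousLinearMap.adjoint (F.symm : Plane →L[ℝ] Plane)
      (ContinuousLinearMap.adjoint (F : Plane →L[ℝ] Plane) ξ) = ξ := by
    intro ξ
    refine ext_inner_left ℝ fun z => ?_
    rw [ContinuousLinearMap.adjoint_inner_right, ContinuousLinearMap.adjoint_inner_right]
    simp
  -- The frequencies allowed for v: composing v with F⁻¹ moves a frequency x to the adjoint of F⁻¹
  -- applied to x, which must fall in Γ.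
  let U₁ : Set Plane :=
    ContinuousLinearMap.adjoint (F.symm : Plane →L[ℝ] Plane) ⁻¹' interior Γ
  have hU₁ : IsOpen U₁ := isOpen_interior.preimage (ContinuousLinearMap.continuous _)
  have hU₁' : U₁.Nonempty := by
    obtain ⟨ξ, hξ⟩ := hΓi
    exact ⟨ContinuousLinearMap.adjoint (F : Plane →L[ℝ] Plane) ξ, by
      rw [mem_preimage, hadj]; exact hξ⟩
  obtain ⟨p, s, hp, hq, hq0⟩ := exists_translate_mem hU₁ hU₁' isOpen_interior hVi
    (fun c hc x hx => hV.smul_mem_interior hc hx) hw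
  have hr : 0 < ‖p + s • w‖ / 2 := half_pos (norm_pos_iff.2 hq0)
  let O : Set Plane := U₁ ∩ {x | x + s • w ∈ interior V ∧ ‖p + s • w‖ / 2 < ‖x + s • w‖}
  have hO : O ∈ 𝓝 p := by
    have hc : Continuous fun x : Plane => x + s • w := by fun_prop
    refine inter_mem (hU₁.mem_nhds hp) (inter_mem ?_ ?_)
    · exact (isOpen_interior.preimage hc).mem_nhds hq
    · exact (isOpen_lt continuous_const hc.norm).mem_nhds (half_lt_self (norm_pos_iff.2 hq0))
  obtain ⟨f, hfO, hfc, hfs, -, hfp⟩ := exists_contDiff_tsupport_subset (n := ⊤) hO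
  have hfc' : HasCompactSupport fun x => (f x : ℂ) := hfc.comp_left (g := Complex.ofReal) rfl
  let a : 𝓢(Plane, ℂ) := hfc'.toSchwartzMap (Complex.ofRealCLM.contDiff.comp hfs)
  have ha : ∀ x, a x = (f x : ℂ) := fun _ => rfl
  have haO : ∀ x, a x ≠ 0 → x ∈ O := fun x hx => hfO (subset_tsupport f (by
    simpa [ha] using hx))
  -- The transform of v is a bump at p. Its translate by s w is the transform of `h`, so `h` is v
  -- times a character of w·x, with frequencies in V away from 0.
  let v : 𝓢(Plane, ℂ) := 𝓕⁻ a
  have hva : 𝓕 v = a := FourierTransform.fourier_fourierInv_eq a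
  let u : 𝓢(Plane, ℂ) := v.compAffine F.symm 0
  let h : 𝓢(Plane, ℂ) := 𝓕⁻ (SchwartzMap.compSubConstCLM ℂ (s • w) a)
  have hha : 𝓕 h = SchwartzMap.compSubConstCLM ℂ (s • w) a :=
    FourierTransform.fourier_fourierInv_eq _
  have hu : ∀ ξ, ξ ∉ Γ → 𝓕 u ξ = 0 := fun ξ hξ =>
    SchwartzMap.fourier_compAffine_eq_zero F.symm 0 v ξ (by
      rw [hva]
      by_contra hne
      have := (haO _ hne).1
      rw [mem_preimage] at this
      refine hξ (interior_subset (s := Γ) ?_)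
      rwa [← hadj ξ])
  have hh : ∀ ξ, 𝓕 h ξ ≠ 0 → ξ ∈ V ∧ ‖p + s • w‖ / 2 ≤ ‖ξ‖ := by
    intro ξ hξ
    rw [hha, SchwartzMap.compSubConstCLM_apply] at hξ
    have := (haO _ hξ).2
    rw [mem_ofPred_eq, sub_add_cancel] at this
    exact ⟨interior_subset this.1, this.2.le⟩
  have hv0 : v = 0 := by
    refine v.eq_zero_of_forall_halfSpace w s hS fun c => ?_
    rw [← key _ hr u h hu hh c]
    refine integral_congr_ae (ae_of_all _ fun x => ?_)
    have h1 : u (F x) = v x := by simp [u, SchwartzMap.compAffine_apply]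
    have h2 : h x = Real.fourierChar (s * inner ℝ w x) • v x := by
      rw [← real_inner_smul_left]
      exact SchwartzMap.fourierInv_compSubConst a (s • w) x
    simp only [h1, h2]
  have ha0 : a p = 0 := by
    rw [← hva, hv0, FourierTransform.fourier_zero]
    rfl
  rw [ha, hfp] at ha0
  simp at ha0

/-! ### Cone symbols acting on Schwartz functions. -/

theorem lintegral_enorm_mul_le {f g : Plane → ℂ} (hf : AEStronglyMeasurable f volume)
    (hg : AEStronglyMeasurable g volume) :
    ∫⁻ x, ‖f x‖ₑ * ‖g x‖ₑ ≤ eLpNorm f 2 volume * eLpNorm g 2 volume := by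
  have h := eLpNorm_smul_le_mul_eLpNorm (p := 2) (q := 2) (r := 1) hg hf
  rw [eLpNorm_one_eq_lintegral_enorm] at h
  simpa [enorm_smul] using h

theorem enorm_integral_mul_conj_le {f g : Plane → ℂ} (hf : AEStronglyMeasurable f volume)
    (hg : AEStronglyMeasurable g volume) :
    ‖∫ x, f x * conj (g x)‖ₑ ≤ eLpNorm f 2 volume * eLpNorm g 2 volume := by
  refine (enorm_integral_le_lintegral_enorm _).trans ?_
  simpa [enorm_mul] using lintegral_enorm_mul_le hf hg

theorem measurable_coneSymbol (t : ℝ) {φ : Metric.sphere (0 : Plane) 1 → ℝ} (hφ : Continuous φ) :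
    Measurable (coneSymbol t φ) := by
  classical
  have hdir : Continuous fun ξ : ({0}ᶜ : Set Plane) => direction ξ.1 ξ.2 := by
    refine Continuous.subtype_mk ?_ _
    exact (continuous_subtype_val.norm.inv₀ fun ξ => norm_ne_zero_iff.2 ξ.2).smul
      continuous_subtype_val
  have hg : Measurable fun ξ : ({0}ᶜ : Set Plane) =>
      (1 + ‖ξ.1‖ ^ 2) ^ (t / 2) * φ (direction ξ.1 ξ.2) := by
    refine (Measurable.pow_const ?_ _).mul (hφ.comp hdir).measurable
    exact (continuous_const.add (continuous_subtype_val.norm.pow 2)).measurable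
  exact Measurable.dite (s := {0}) (f := fun _ => (0 : ℝ)) measurable_const hg
    (measurableSet_singleton 0)

theorem abs_coneSymbol_le (t : ℝ) {φ : Metric.sphere (0 : Plane) 1 → ℝ}
    (hφ : ∀ ξ, φ ξ ∈ Icc (0 : ℝ) 1) (ξ : Plane) :
    |coneSymbol t φ ξ| ≤ (1 + ‖ξ‖ ^ 2) ^ (t / 2) := by
  have hpos : 0 ≤ (1 + ‖ξ‖ ^ 2) ^ (t / 2) := by positivity
  unfold coneSymbol
  split_ifs with h
  · simpa using hpos
  · rw [abs_mul, abs_of_nonneg hpos, abs_of_nonneg (hφ _).1]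
    exact mul_le_of_le_one_right hpos (hφ _).2

theorem ConeSystem.continuous_phiPlus (Θ : ConeSystem) : Continuous Θ.phiPlus :=
  Θ.smooth_phiPlus.continuous

theorem ConeSystem.continuous_phiMinus (Θ : ConeSystem) : Continuous Θ.phiMinus :=
  continuous_const.sub Θ.continuous_phiPlus

theorem ConeSystem.phiMinus_mem (Θ : ConeSystem) (ξ) : Θ.phiMinus ξ ∈ Icc (0 : ℝ) 1 := by
  have := Θ.phiPlus_mem ξ
  exact ⟨sub_nonneg.2 this.2, sub_le_self _ this.1⟩

theorem coneSymbol_phiPlus_of_mem_plus (Θ : ConeSystem) (t : ℝ) {ξ : Plane} (h : ξ ≠ 0)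
    (hξ : ξ ∈ Θ.plus) : coneSymbol t Θ.phiPlus ξ = (1 + ‖ξ‖ ^ 2) ^ (t / 2) := by
  rw [coneSymbol, dif_neg h, Θ.phiPlus_eq_one _ (Θ.isCone_plus _ _ hξ), mul_one]

theorem coneSymbol_phiPlus_of_mem_minus (Θ : ConeSystem) (t : ℝ) {ξ : Plane}
    (hξ : ξ ∈ Θ.minus) : coneSymbol t Θ.phiPlus ξ = 0 := by
  by_cases h : ξ = 0
  · rw [coneSymbol, dif_pos h]
  · rw [coneSymbol, dif_neg h, Θ.phiPlus_eq_zero _ (Θ.isCone_minus _ _ hξ), mul_zero]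

theorem hasTemperateGrowth_weight (t : ℝ) :
    Function.HasTemperateGrowth fun ξ : Plane => (1 + ‖(2 * Real.pi) • ξ‖ ^ 2) ^ (t / 2) :=
  (Function.hasTemperateGrowth_one_add_norm_sq_rpow Plane (t / 2)).comp
    ((2 * Real.pi) • ContinuousLinearMap.id ℝ Plane).hasTemperateGrowth

/-- The Fourier transform of `v` multiplied by the isotropic Sobolev weight of order `t`. -/
def weightedFourier (t : ℝ) (v : 𝓢(Plane, ℂ)) : 𝓢(Plane, ℂ) :=
  SchwartzMap.smulLeftCLM ℂ (fun ξ : Plane => (1 + ‖(2 * Real.pi) • ξ‖ ^ 2) ^ (t / 2)) (𝓕 v)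

theorem weightedFourier_apply (t : ℝ) (v : 𝓢(Plane, ℂ)) (ξ : Plane) :
    weightedFourier t v ξ = ((1 + ‖(2 * Real.pi) • ξ‖ ^ 2) ^ (t / 2) : ℝ) • 𝓕 v ξ :=
  SchwartzMap.smulLeftCLM_apply_apply (hasTemperateGrowth_weight t) _ _

theorem continuous_weightedFourier (t : ℝ) : Continuous (weightedFourier t) :=
  (SchwartzMap.smulLeftCLM ℂ _).continuous.comp
    (FourierTransform.fourierCLM ℂ 𝓢(Plane, ℂ)).continuous

/-- The Fourier transform of `v` multiplied by a cone symbol. -/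
def symbolFourier (t : ℝ) (φ : Metric.sphere (0 : Plane) 1 → ℝ) (v : 𝓢(Plane, ℂ)) (ξ : Plane) : ℂ :=
  (coneSymbol t φ ((2 * Real.pi) • ξ) : ℂ) * 𝓕 v ξ

section Symbol

variable (t : ℝ) {φ : Metric.sphere (0 : Plane) 1 → ℝ} (v : 𝓢(Plane, ℂ))

theorem norm_symbolFourier_le (hφ : ∀ ξ, φ ξ ∈ Icc (0 : ℝ) 1) (ξ : Plane) :
    ‖symbolFourier t φ v ξ‖ ≤ ‖weightedFourier t v ξ‖ := by
  rw [symbolFourier, weightedFourier_apply, norm_mul, norm_smul, Complex.norm_real]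
  gcongr
  rw [Real.norm_eq_abs, Real.norm_of_nonneg (by positivity)]
  exact abs_coneSymbol_le t hφ _

theorem aestronglyMeasurable_symbolFourier (hφc : Continuous φ) :
    AEStronglyMeasurable (symbolFourier t φ v) volume := by
  have h : Measurable fun ξ : Plane => coneSymbol t φ ((2 * Real.pi) • ξ) :=
    (measurable_coneSymbol t hφc).comp (measurable_const_smul _)
  exact (Complex.measurable_ofReal.comp h).aestronglyMeasurable.mul
    (𝓕 v).continuous.aestronglyMeasurable

theorem eLpNorm_symbolOp (hφc : Continuous φ) (hφ : ∀ ξ, φ ξ ∈ Icc (0 : ℝ) 1) :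
    eLpNorm (symbolOp (coneSymbol t φ) v) 2 volume = eLpNorm (symbolFourier t φ v) 2 volume := by
  have hb := ae_of_all volume (norm_symbolFourier_le t v hφ)
  exact eLpNorm_fourierInv_eq
    ((weightedFourier t v).integrable.mono (aestronglyMeasurable_symbolFourier t v hφc) hb)
    (((weightedFourier t v).memLp 2).mono (aestronglyMeasurable_symbolFourier t v hφc) hb)

theorem eLpNorm_symbolFourier_le (hφ : ∀ ξ, φ ξ ∈ Icc (0 : ℝ) 1) :
    eLpNorm (symbolFourier t φ v) 2 volume ≤ eLpNorm (weightedFourier t v) 2 volume :=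
  eLpNorm_mono (norm_symbolFourier_le t v hφ)

theorem symbolFourier_add (u : 𝓢(Plane, ℂ)) :
    symbolFourier t φ (u + v) = symbolFourier t φ u + symbolFourier t φ v := by
  funext ξ
  have : 𝓕 (u + v) ξ = 𝓕 u ξ + 𝓕 v ξ := by rw [FourierTransform.fourier_add]; rfl
  simp only [symbolFourier, Pi.add_apply, this, mul_add]

end Symbol

/-! ### The anisotropic norm: approximation, upper bound, decay. -/

section Norm

variable (Θ : ConeSystem) (t : ℝ)

theorem anisoNorm_eq (v : 𝓢(Plane, ℂ)) :
    anisoNorm Θ 2 t 0 v = eLpNorm (symbolFourier t Θ.phiPlus v) 2 volume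
      + eLpNorm (symbolFourier 0 Θ.phiMinus v) 2 volume := by
  rw [anisoNorm, eLpNorm_symbolOp t v Θ.continuous_phiPlus Θ.phiPlus_mem,
    eLpNorm_symbolOp 0 v Θ.continuous_phiMinus Θ.phiMinus_mem]

theorem anisoNorm_add_le (u v : 𝓢(Plane, ℂ)) :
    anisoNorm Θ 2 t 0 (u + v : 𝓢(Plane, ℂ)) ≤ anisoNorm Θ 2 t 0 u + anisoNorm Θ 2 t 0 v := by
  simp only [anisoNorm_eq, symbolFourier_add]
  have h1 := eLpNorm_add_le (aestronglyMeasurable_symbolFourier t u Θ.continuous_phiPlus)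
    (aestronglyMeasurable_symbolFourier t v Θ.continuous_phiPlus) (p := 2) (by norm_num)
  have h2 := eLpNorm_add_le (aestronglyMeasurable_symbolFourier 0 u Θ.continuous_phiMinus)
    (aestronglyMeasurable_symbolFourier 0 v Θ.continuous_phiMinus) (p := 2) (by norm_num)
  exact (add_le_add h1 h2).trans_eq (add_add_add_comm _ _ _ _)

theorem anisoNorm_neg (v : 𝓢(Plane, ℂ)) :
    anisoNorm Θ 2 t 0 (-v : 𝓢(Plane, ℂ)) = anisoNorm Θ 2 t 0 v := by
  have h : ∀ (r : ℝ) (φ), symbolFourier r φ (-v) = -symbolFourier r φ v := by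
    intro r φ
    funext ξ
    have : 𝓕 (-v) ξ = -𝓕 v ξ := by rw [FourierTransform.fourier_neg]; rfl
    simp only [symbolFourier, Pi.neg_apply, this, mul_neg]
  simp only [anisoNorm_eq, h, eLpNorm_neg]

theorem anisoNorm_le_weightedFourier (v : 𝓢(Plane, ℂ)) :
    anisoNorm Θ 2 t 0 v ≤ eLpNorm (weightedFourier t v) 2 volume
      + eLpNorm (weightedFourier 0 v) 2 volume := by
  rw [anisoNorm_eq]
  exact add_le_add (eLpNorm_symbolFourier_le t v Θ.phiPlus_mem)
    (eLpNorm_symbolFourier_le 0 v Θ.phiMinus_mem)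

theorem anisoNorm_ne_top (v : 𝓢(Plane, ℂ)) : anisoNorm Θ 2 t 0 v ≠ ⊤ := by
  have h1 := (weightedFourier t v).eLpNorm_lt_top 2 volume
  have h2 := (weightedFourier 0 v).eLpNorm_lt_top 2 volume
  exact ((anisoNorm_le_weightedFourier Θ t v).trans_lt (ENNReal.add_lt_top.2 ⟨h1, h2⟩)).ne

theorem tendsto_eLpNorm_schwartz {v : ℕ → 𝓢(Plane, ℂ)} (T : 𝓢(Plane, ℂ) → 𝓢(Plane, ℂ))
    (hT : Continuous T) (hT0 : T 0 = 0) (hv : Tendsto v atTop (𝓝 0)) :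
    Tendsto (fun n => eLpNorm (T (v n)) 2 volume) atTop (𝓝 0) := by
  have hc : Continuous fun s : 𝓢(Plane, ℂ) => ‖(T s).toLp 2‖ₑ :=
    (SchwartzMap.continuous_toLp.comp hT).enorm
  have h := (hc.tendsto 0).comp hv
  have h0 : ‖(T 0).toLp 2‖ₑ = 0 := by
    rw [hT0]
    exact enorm_eq_zero.2 (map_zero (SchwartzMap.toLpCLM ℂ ℂ 2 (volume : Measure Plane)))
  rw [h0] at h
  refine h.congr fun n => ?_
  simp only [Function.comp_apply]
  rw [Lp.enorm_def, eLpNorm_congr_ae ((T (v n)).coeFn_toLp 2 volume)]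

theorem weightedFourier_zero (t : ℝ) : weightedFourier t 0 = 0 := by
  ext ξ
  rw [weightedFourier_apply, FourierTransform.fourier_zero]
  simp

/-- Both norms are controlled by continuous functions on the Schwartz space, where compact supports
are dense. This is needed because a nonzero function with frequencies in a proper closed cone never
has compact support. -/
theorem exists_test_approx (s : 𝓢(Plane, ℂ)) {ε : ℝ≥0∞} (hε : 0 < ε) :
    ∃ v : 𝓢(Plane, ℂ), IsTestFunction v ∧ anisoNorm Θ 2 t 0 (v - s : 𝓢(Plane, ℂ)) < ε ∧
      eLpNorm (v - s : 𝓢(Plane, ℂ)) 2 volume < ε := by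
  obtain ⟨v, hvc, hv⟩ := s.exists_tendsto_hasCompactSupport
  have hv0 : Tendsto (fun n => v n - s) atTop (𝓝 0) := by
    simpa using hv.sub_const s
  have h1 := tendsto_eLpNorm_schwartz _ (continuous_weightedFourier t) (weightedFourier_zero t) hv0
  have h2 := tendsto_eLpNorm_schwartz _ (continuous_weightedFourier 0) (weightedFourier_zero 0) hv0
  have h3 := tendsto_eLpNorm_schwartz id continuous_id rfl hv0
  have h12 := h1.add h2
  rw [add_zero] at h12
  obtain ⟨n, hn, hn'⟩ := ((h12.eventually (gt_mem_nhds hε)).and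
    (h3.eventually (gt_mem_nhds hε))).exists
  exact ⟨v n, ⟨(v n).smooth ⊤, hvc n⟩, (anisoNorm_le_weightedFourier Θ t _).trans_lt hn, hn'⟩

/-- On C₋ the symbol of order t vanishes, and the remaining symbol has order 0, hence is at most 1;
Plancherel does the rest. -/
theorem anisoNorm_le_of_fourier_eq_zero (v : 𝓢(Plane, ℂ)) (h : ∀ ξ, ξ ∉ Θ.minus → 𝓕 v ξ = 0) :
    anisoNorm Θ 2 t 0 v ≤ eLpNorm v 2 volume := by
  have h1 : symbolFourier t Θ.phiPlus v = 0 := by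
    funext ξ
    by_cases hξ : ξ ∈ Θ.minus
    · rw [symbolFourier, coneSymbol_phiPlus_of_mem_minus Θ t (Θ.isCone_minus _ _ hξ)]
      simp
    · simp [symbolFourier, h ξ hξ]
  rw [anisoNorm_eq, h1, eLpNorm_zero, zero_add, ← v.eLpNorm_fourier_eq]
  refine eLpNorm_mono fun ξ => (norm_symbolFourier_le 0 v Θ.phiMinus_mem ξ).trans_eq ?_
  rw [weightedFourier_apply]
  simp

/-- By Parseval only frequencies in C₊ beyond R contribute, where the plus symbol is at least R^t;
dividing by it and applying Cauchy–Schwarz gives the gain R^(-t). -/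
theorem enorm_integral_mul_conj_le_anisoNorm (ht : 0 < t) {R : ℝ} (hR : 0 < R)
    (v h : 𝓢(Plane, ℂ)) (hh : ∀ ξ, 𝓕 h ξ ≠ 0 → ξ ∈ Θ.plus ∧ R ≤ ‖ξ‖) :
    ‖∫ x, v x * conj (h x)‖ₑ ≤
      anisoNorm Θ 2 t 0 v * (ENNReal.ofReal (R ^ (-t)) * eLpNorm h 2 volume) := by
  have hP : ∫ x, v x * conj (h x) = ∫ ξ, 𝓕 v ξ * conj (𝓕 h ξ) := by
    have := SchwartzMap.integral_inner_fourier_fourier h v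
    simpa [RCLike.inner_apply] using this.symm
  have hpt : ∀ ξ, ‖𝓕 v ξ‖ₑ * ‖𝓕 h ξ‖ₑ ≤
      ENNReal.ofReal (R ^ (-t)) * (‖symbolFourier t Θ.phiPlus v ξ‖ₑ * ‖𝓕 h ξ‖ₑ) := by
    intro ξ
    by_cases h0 : 𝓕 h ξ = 0
    · simp [h0]
    obtain ⟨hmem, hRξ⟩ := hh ξ h0
    rw [← mul_assoc]
    gcongr
    have hξ0 : ξ ≠ 0 := norm_pos_iff.1 (hR.trans_le hRξ)
    have h2 : (2 * Real.pi) • ξ ≠ 0 := smul_ne_zero (by positivity) hξ0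
    have hsym : R ^ t ≤ coneSymbol t Θ.phiPlus ((2 * Real.pi) • ξ) := by
      rw [coneSymbol_phiPlus_of_mem_plus Θ t h2 (Θ.isCone_plus _ _ hmem)]
      have e : R ^ t = (R ^ 2) ^ (t / 2) := by
        rw [← Real.rpow_natCast, ← Real.rpow_mul hR.le]; congr 1; push_cast; ring
      rw [e]
      refine Real.rpow_le_rpow (by positivity) ?_ (by positivity)
      have hpi : (1 : ℝ) ≤ 2 * Real.pi := by linarith [Real.pi_gt_three]
      have : R ≤ ‖(2 * Real.pi) • ξ‖ := by
        rw [norm_smul, Real.norm_of_nonneg (by positivity)]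
        exact hRξ.trans (le_mul_of_one_le_left (norm_nonneg _) hpi)
      have := pow_le_pow_left₀ hR.le this 2
      linarith
    rw [← ofReal_norm, ← ofReal_norm, ← ENNReal.ofReal_mul (by positivity)]
    refine ENNReal.ofReal_le_ofReal ?_
    rw [symbolFourier, norm_mul, Complex.norm_real, Real.norm_eq_abs, ← mul_assoc]
    refine le_mul_of_one_le_left (norm_nonneg _) ?_
    rw [Real.rpow_neg hR.le, ← div_eq_inv_mul, one_le_div (by positivity)]
    exact hsym.trans (le_abs_self _)
  calc ‖∫ x, v x * conj (h x)‖ₑ ≤ ∫⁻ ξ, ‖𝓕 v ξ * conj (𝓕 h ξ)‖ₑ := by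
        rw [hP]; exact enorm_integral_le_lintegral_enorm _
    _ ≤ ∫⁻ ξ, ENNReal.ofReal (R ^ (-t)) * (‖symbolFourier t Θ.phiPlus v ξ‖ₑ * ‖𝓕 h ξ‖ₑ) := by
        refine lintegral_mono fun ξ => ?_
        simpa [enorm_mul] using hpt ξ
    _ = ENNReal.ofReal (R ^ (-t)) * ∫⁻ ξ, ‖symbolFourier t Θ.phiPlus v ξ‖ₑ * ‖𝓕 h ξ‖ₑ :=
        lintegral_const_mul' _ _ ENNReal.ofReal_ne_top
    _ ≤ ENNReal.ofReal (R ^ (-t)) * (anisoNorm Θ 2 t 0 v * eLpNorm h 2 volume) := by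
        gcongr
        refine (lintegral_enorm_mul_le (aestronglyMeasurable_symbolFourier t v
          Θ.continuous_phiPlus) (𝓕 h).continuous.aestronglyMeasurable).trans ?_
        rw [h.eLpNorm_fourier_eq, anisoNorm_eq]
        gcongr
        exact le_self_add
    _ = _ := by ring

/-- Elements of the anisotropic space decay at high frequencies in the cone `C₊`. -/
theorem exists_norm_integral_mul_conj_le (ht : 0 < t) {f : Plane → ℂ} (hf : f ∈ anisoSpace Θ t) :
    ∃ M : ℝ, 0 ≤ M ∧ ∀ R : ℝ, 0 < R → ∀ h : 𝓢(Plane, ℂ),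
      (∀ ξ, 𝓕 h ξ ≠ 0 → ξ ∈ Θ.plus ∧ R ≤ ‖ξ‖) →
      ‖∫ x, f x * conj (h x)‖ ≤ M * (R ^ (-t) * ‖h.toLp 2‖) := by
  obtain ⟨hf2, u, hu, hcauchy, hlim⟩ := hf
  let s : ℕ → 𝓢(Plane, ℂ) := fun n => (hu n).2.toSchwartzMap (hu n).1
  have hs : ∀ n, (s n : Plane → ℂ) = u n := fun n => rfl
  -- The Cauchy property bounds the norms of the approximants by 1 plus that of `s N`. With this
  -- bound the pairing estimate passes to the L² limit.
  obtain ⟨N, hN⟩ : ∃ N, ∀ n ≥ N, anisoNorm Θ 2 t 0 (s n - s N : 𝓢(Plane, ℂ)) ≤ 1 := by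
    obtain ⟨⟨a, b⟩, hab⟩ := eventually_atTop.1 (hcauchy.eventually (gt_mem_nhds one_pos))
    exact ⟨max a b, fun n hn => (hab (n, max a b)
      ⟨(le_max_left a b).trans hn, le_max_right a b⟩).le⟩
  have hM : 1 + anisoNorm Θ 2 t 0 (s N) ≠ ⊤ :=
    ENNReal.add_ne_top.2 ⟨ENNReal.one_ne_top, anisoNorm_ne_top Θ t _⟩
  refine ⟨(1 + anisoNorm Θ 2 t 0 (s N)).toReal, ENNReal.toReal_nonneg, fun R hR h hh => ?_⟩
  set K : ℝ≥0∞ := ENNReal.ofReal (R ^ (-t)) * eLpNorm h 2 volume with hK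
  have hh2 := h.memLp 2 (volume : Measure Plane)
  have hint : ∀ {g : Plane → ℂ}, MemLp g 2 volume → Integrable fun x => g x * conj (h x) :=
    fun hg => MemLp.integrable_mul hg hh2.star
  have hle : ∀ n ≥ N, ‖∫ x, f x * conj (h x)‖ₑ ≤
      eLpNorm (u n - f) 2 volume * eLpNorm h 2 volume + (1 + anisoNorm Θ 2 t 0 (s N)) * K := by
    intro n hn
    have hd : MemLp (u n - f) 2 volume := ((s n).memLp 2).sub hf2
    have e : ∫ x, f x * conj (h x) = (-(∫ x, (u n - f) x * conj (h x)))
        + ((∫ x, (s n - s N : 𝓢(Plane, ℂ)) x * conj (h x)) + ∫ x, s N x * conj (h x)) := by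
      have e1 : ∫ x, s n x * conj (h x) = (∫ x, (s n - s N : 𝓢(Plane, ℂ)) x * conj (h x))
          + ∫ x, s N x * conj (h x) := by
        rw [← integral_add (hint ((s n - s N).memLp 2 volume)) (hint ((s N).memLp 2 volume))]
        refine integral_congr_ae (ae_of_all _ fun x => ?_)
        simp only [sub_apply]
        ring
      have e2 : ∫ x, (u n - f) x * conj (h x) = (∫ x, s n x * conj (h x))
          - ∫ x, f x * conj (h x) := by
        rw [← integral_sub (hint ((s n).memLp 2 volume)) (hint hf2)]
        refine integral_congr_ae (ae_of_all _ fun x => ?_)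
        simp only [Pi.sub_apply, hs]
        ring
      rw [← e1, e2]
      ring
    rw [e]
    refine (enorm_add_le _ _).trans (add_le_add ?_ ((enorm_add_le _ _).trans ?_))
    · rw [enorm_neg]
      exact enorm_integral_mul_conj_le hd.1 hh2.1
    · rw [add_mul]
      refine add_le_add ?_ (enorm_integral_mul_conj_le_anisoNorm Θ t ht hR _ h hh)
      refine (enorm_integral_mul_conj_le_anisoNorm Θ t ht hR _ h hh).trans ?_
      gcongr
      exact hN n hn
  have hfin : ‖∫ x, f x * conj (h x)‖ₑ ≤ (1 + anisoNorm Θ 2 t 0 (s N)) * K := by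
    have h1 : Tendsto (fun n => eLpNorm (u n - f) 2 volume * eLpNorm h 2 volume) atTop (𝓝 0) := by
      simpa using ENNReal.Tendsto.mul_const hlim (Or.inr hh2.2.ne)
    have h2 := h1.add_const ((1 + anisoNorm Θ 2 t 0 (s N)) * K)
    rw [zero_add] at h2
    exact ge_of_tendsto h2 (eventually_atTop.2 ⟨N, hle⟩)
  have hKtop : K ≠ ⊤ := ENNReal.mul_ne_top ENNReal.ofReal_ne_top hh2.2.ne
  have := ENNReal.toReal_mono (ENNReal.mul_ne_top hM hKtop) hfin
  rwa [toReal_enorm, ENNReal.toReal_mul, hK, ENNReal.toReal_mul,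
    ENNReal.toReal_ofReal (by positivity), ← SchwartzMap.norm_toLp] at this

end Norm

/-! ### Frequencies in the minus cone and uniform boundedness. -/

/-- The classes in `L²` of the Schwartz functions whose Fourier transform vanishes off `Γ`. -/
def freqSubmodule (Γ : Set Plane) : Submodule ℂ (Lp ℂ 2 (volume : Measure Plane)) :=
  Submodule.map (SchwartzMap.toLpCLM ℂ ℂ 2 (volume : Measure Plane)).toLinearMap
    { carrier := {u : 𝓢(Plane, ℂ) | ∀ ξ, ξ ∉ Γ → 𝓕 u ξ = 0}
      add_mem' := fun {u v} hu hv ξ hξ => by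
        rw [FourierTransform.fourier_add, add_apply, hu ξ hξ, hv ξ hξ, add_zero]
      zero_mem' := fun ξ _ => by rw [FourierTransform.fourier_zero]; rfl
      smul_mem' := fun c u hu ξ hξ => by
        rw [FourierTransform.fourier_smul, smul_apply, hu ξ hξ, smul_zero] }

theorem mem_freqSubmodule {Γ : Set Plane} {x : Lp ℂ 2 (volume : Measure Plane)} :
    x ∈ freqSubmodule Γ ↔ ∃ u : 𝓢(Plane, ℂ), (∀ ξ, ξ ∉ Γ → 𝓕 u ξ = 0) ∧ u.toLp 2 = x :=
  Iff.rfl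

/-- L² convergence of functions with frequencies in C₋ is already convergence in the anisotropic
norm. The closure supplies the complete space on which uniform boundedness is applied. -/
theorem mem_anisoSpace_of_mem_closure (Θ : ConeSystem) (t : ℝ)
    {x : Lp ℂ 2 (volume : Measure Plane)} (hx : x ∈ (freqSubmodule Θ.minus).topologicalClosure) :
    (x : Plane → ℂ) ∈ anisoSpace Θ t := by
  obtain ⟨y, hy, hyx⟩ := mem_closure_iff_seq_limit.1 hx
  choose s hs hsy using fun n => mem_freqSubmodule.1 (hy n)
  have hpos : ∀ n : ℕ, (0 : ℝ≥0∞) < ((n : ℝ≥0∞) + 1)⁻¹ := fun n =>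
    ENNReal.inv_pos.2 (ENNReal.add_ne_top.2 ⟨ENNReal.natCast_ne_top n, ENNReal.one_ne_top⟩)
  choose v hvt hva hvl using fun n => exists_test_approx Θ t (s n) (hpos n)
  have hsx : ∀ n, eLpNorm ((s n : Plane → ℂ) - (x : Plane → ℂ)) 2 volume = ‖y n - x‖ₑ := by
    intro n
    rw [Lp.enorm_def]
    refine eLpNorm_congr_ae ?_
    filter_upwards [Lp.coeFn_sub (y n) x, hsy n ▸ (s n).coeFn_toLp 2 volume] with z h1 h2
    rw [h1, Pi.sub_apply, Pi.sub_apply, h2]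
  -- The error of the compactly supported approximation plus the L² distance of `y n` to the limit;
  -- it majorizes the L² error, and `e m + e n` majorizes the anisotropic distances.
  let e : ℕ → ℝ≥0∞ := fun n => ((n : ℝ≥0∞) + 1)⁻¹ + ‖y n - x‖ₑ
  have he : Tendsto e atTop (𝓝 0) := by
    have h1 : Tendsto (fun n : ℕ => ((n : ℝ≥0∞) + 1)⁻¹) atTop (𝓝 0) := by
      have := (ENNReal.tendsto_inv_nat_nhds_zero).comp (tendsto_add_atTop_nat 1)
      refine this.congr fun n => ?_
      simp
    have h2 : Tendsto (fun n => ‖y n - x‖ₑ) atTop (𝓝 0) := by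
      have := (hyx.sub_const x).enorm
      simpa using this
    simpa using h1.add h2
  have hle : ∀ n, eLpNorm ((v n : Plane → ℂ) - (x : Plane → ℂ)) 2 volume ≤ e n := by
    intro n
    have h := eLpNorm_add_le (μ := volume) (p := 2)
      ((v n - s n : 𝓢(Plane, ℂ)).continuous.aestronglyMeasurable)
      ((s n).continuous.aestronglyMeasurable.sub (Lp.aestronglyMeasurable x)) (by norm_num)
    have hf : ((v n - s n : 𝓢(Plane, ℂ)) : Plane → ℂ) + ((s n : Plane → ℂ) - (x : Plane → ℂ)) = (v n : Plane → ℂ) - (x : Plane → ℂ) := by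
      funext z; simp
    rw [hf, hsx] at h
    exact h.trans (add_le_add_left (hvl n).le _)
  refine ⟨Lp.memLp x, fun n => v n, hvt, ?_, ?_⟩
  · have hbound : ∀ q : ℕ × ℕ,
        anisoNorm Θ 2 t 0 ((v q.1 : Plane → ℂ) - v q.2) ≤ e q.1 + e q.2 := by
      rintro ⟨m, n⟩
      have hsub : anisoNorm Θ 2 t 0 (s m - s n : 𝓢(Plane, ℂ)) ≤ ‖y m - x‖ₑ + ‖y n - x‖ₑ := by
        refine (anisoNorm_le_of_fourier_eq_zero Θ t _ fun ξ hξ => ?_).trans ?_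
        · rw [sub_eq_add_neg, FourierTransform.fourier_add, FourierTransform.fourier_neg, add_apply,
            neg_apply, hs m ξ hξ, hs n ξ hξ, neg_zero, add_zero]
        · have h := eLpNorm_sub_le (μ := volume) (p := 2)
            ((s m).continuous.aestronglyMeasurable.sub (Lp.aestronglyMeasurable x))
            ((s n).continuous.aestronglyMeasurable.sub (Lp.aestronglyMeasurable x)) (by norm_num)
          have hf : ((s m : Plane → ℂ) - (x : Plane → ℂ)) - ((s n : Plane → ℂ) - (x : Plane → ℂ)) = (s m - s n : 𝓢(Plane, ℂ)) := by
            funext z; simp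
          rwa [hf, hsx, hsx] at h
      have hneg : anisoNorm Θ 2 t 0 (s n - v n : 𝓢(Plane, ℂ)) ≤ ((n : ℝ≥0∞) + 1)⁻¹ := by
        rw [← neg_sub, anisoNorm_neg]
        exact (hva n).le
      have hdec : (v m : Plane → ℂ) - v n
          = ((v m - s m) + ((s m - s n) + (s n - v n)) : 𝓢(Plane, ℂ)) := by
        funext z; simp
      rw [hdec]
      refine (anisoNorm_add_le Θ t _ _).trans ((add_le_add (hva m).le
        ((anisoNorm_add_le Θ t _ _).trans (add_le_add hsub hneg))).trans_eq ?_)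
      simp only [e]
      ring
    have hsum : Tendsto (fun q : ℕ × ℕ => e q.1 + e q.2) atTop (𝓝 0) := by
      rw [← prod_atTop_atTop_eq]
      simpa using (he.comp tendsto_fst).add (he.comp tendsto_snd)
    exact tendsto_of_tendsto_of_tendsto_of_le_of_le tendsto_const_nhds hsum
      (fun _ => zero_le) hbound
  · exact tendsto_of_tendsto_of_tendsto_of_le_of_le tendsto_const_nhds he
      (fun _ => zero_le) hle

/-- Substituting y = F z turns the pairing into an inner product against a fixed L² function, up to
the Jacobian. -/
theorem exists_continuousLinearMap_pairing (F : Plane ≃L[ℝ] Plane) {E : Set Plane}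
    (hE : MeasurableSet E) (h : 𝓢(Plane, ℂ)) :
    ∃ L : Lp ℂ 2 (volume : Measure Plane) →L[ℂ] ℂ,
      ∀ x, L x = ∫ z in E, (x : Plane → ℂ) (F z) * conj (h z) := by
  let k : Plane → ℂ := indicator (F.symm ⁻¹' E) (h.compAffine F.symm 0)
  have hm : MeasurableSet (F.symm ⁻¹' E) := F.symm.continuous.measurable hE
  have hk : MemLp k 2 volume := ((h.compAffine F.symm 0).memLp 2 volume).indicator hm
  refine ⟨((|(LinearMap.det (F : Plane →ₗ[ℝ] Plane))⁻¹| : ℝ) : ℂ) • innerSL ℂ (hk.toLp k),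
    fun x => ?_⟩
  have h1 : inner ℂ (hk.toLp k) x = ∫ y, x y * conj (k y) := by
    rw [L2.inner_def]
    refine integral_congr_ae ?_
    filter_upwards [hk.coeFn_toLp] with y hy
    rw [hy, RCLike.inner_apply]
  rw [smul_apply, innerSL_apply_apply, h1, smul_eq_mul, ← Complex.real_smul,
    ← integral_comp_affine F 0, ← integral_indicator hE]
  refine integral_congr_ae (ae_of_all _ fun z => ?_)
  by_cases hz : z ∈ E
  · simp [k, hz, SchwartzMap.compAffine_apply]
  · simp [k, hz]

theorem setIntegral_toLp_comp (F : Plane ≃L[ℝ] Plane) (E : Set Plane) (u h : 𝓢(Plane, ℂ)) :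
    ∫ z in E, (u.toLp 2 : Lp ℂ 2 (volume : Measure Plane)) (F z) * conj (h z)
      = ∫ z in E, u (F z) * conj (h z) := by
  have hqmp : Measure.QuasiMeasurePreserving F (volume : Measure Plane) volume := by
    refine ⟨F.continuous.measurable, ?_⟩
    have h2 := Measure.map_linearMap_addHaar_eq_smul_addHaar (volume : Measure Plane)
      (LinearEquiv.isUnit_det' F.toLinearEquiv).ne_zero
    have h3 : Measure.map F (volume : Measure Plane)
        = Measure.map (F.toLinearEquiv : Plane →ₗ[ℝ] Plane) volume := rfl
    rw [h3, h2]
    exact Measure.smul_absolutelyContinuous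
  refine integral_congr_ae (ae_restrict_of_ae ?_)
  filter_upwards [hqmp.ae_eq_comp (u.coeFn_toLp 2 volume)] with z hz
  simp only [Function.comp_apply] at hz
  rw [hz]

theorem eq_zero_of_norm_toLp_eq_zero {h : 𝓢(Plane, ℂ)}
    (h0 : ‖h.toLp 2 (volume : Measure Plane)‖ = 0) : h = 0 := by
  have hm := h.memLp 2 (volume : Measure Plane)
  rw [SchwartzMap.norm_toLp, ENNReal.toReal_eq_zero_iff, or_iff_left hm.2.ne,
    eLpNorm_eq_zero_iff hm.1 (by norm_num)] at h0
  exact DFunLike.coe_injective ((Continuous.ae_eq_iff_eq volume h.continuous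
    (0 : 𝓢(Plane, ℂ)).continuous).1 h0)

/-- The uniform boundedness principle on a complete subspace, for weighted functionals. -/
theorem exists_forall_mul_norm_le {W ι : Type*} [NormedAddCommGroup W] [NormedSpace ℂ W]
    (X : Submodule ℂ W) [CompleteSpace X] (L : ι → W →L[ℂ] ℂ) (r : ι → ℝ) (hr : ∀ i, 0 ≤ r i)
    (h : ∀ x ∈ X, ∃ M, ∀ i, r i * ‖L i x‖ ≤ M) :
    ∃ C, ∀ i, ∀ x ∈ X, r i * ‖L i x‖ ≤ C * ‖x‖ := by
  let g : ι → X →L[ℂ] ℂ := fun i => (r i : ℂ) • (L i).comp X.subtypeL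
  have hg : ∀ (i : ι) (x : X), ‖g i x‖ = r i * ‖L i x‖ := by
    intro i x
    simp only [g, smul_apply, norm_smul, Complex.norm_real, Real.norm_of_nonneg (hr i)]
    rfl
  obtain ⟨C, hC⟩ := banach_steinhaus (g := g) fun x => by
    simpa only [hg] using h x x.2
  refine ⟨C, fun i x hx => ?_⟩
  have := (g i).le_of_opNorm_le (hC i) ⟨x, hx⟩
  rwa [hg] at this

theorem integral_cutoffOp_mul_conj (F : Plane ≃L[ℝ] Plane) {E : Set Plane}
    (hE : MeasurableSet E) (f h : Plane → ℂ) :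
    ∫ z, cutoffOp E (F : Plane →ₗ[ℝ] Plane) f z * conj (h z)
      = ∫ z in E, f (F z) * conj (h z) := by
  rw [← integral_indicator hE]
  refine integral_congr_ae (ae_of_all _ fun z => ?_)
  by_cases hz : z ∈ E
  · simp only [cutoffOp, indicator_of_mem hz, one_mul]; rfl
  · simp only [cutoffOp, indicator_of_notMem hz, zero_mul]

/-- If the cutoff maps one anisotropic space into another, then its pairings with functions of high
frequency in the target cone decay uniformly. -/
theorem exists_pairing_bound_of_mapsTo (F : Plane ≃L[ℝ] Plane) {E : Set Plane}
    (hE : MeasurableSet E) {Θ₁ Θ₂ : ConeSystem} {t : ℝ} (ht : 0 < t)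
    (hmaps : MapsTo (cutoffOp E (F : Plane →ₗ[ℝ] Plane)) (anisoSpace Θ₁ t) (anisoSpace Θ₂ t)) :
    ∃ C : ℝ, ∀ R : ℝ, 0 < R → ∀ u h : 𝓢(Plane, ℂ), (∀ ξ, ξ ∉ Θ₁.minus → 𝓕 u ξ = 0) →
      (∀ ξ, 𝓕 h ξ ≠ 0 → ξ ∈ Θ₂.plus ∧ R ≤ ‖ξ‖) →
      ‖∫ x in E, u (F x) * conj (h x)‖ ≤ C * R ^ (-t) * (‖u.toLp 2‖ * ‖h.toLp 2‖) := by
  choose L hL using exists_continuousLinearMap_pairing F hE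
  have : CompleteSpace (freqSubmodule Θ₁.minus).topologicalClosure :=
    (freqSubmodule Θ₁.minus).isClosed_topologicalClosure.completeSpace_coe
  -- The functionals are indexed by radius and test function together and weighted by R^t / ‖h‖, so
  -- that boundedness is uniform in both. For ‖h‖ = 0 division by zero makes the weight 0.
  let ι := {p : ℝ × 𝓢(Plane, ℂ) // 0 < p.1 ∧ ∀ ξ, 𝓕 p.2 ξ ≠ 0 → ξ ∈ Θ₂.plus ∧ p.1 ≤ ‖ξ‖}
  obtain ⟨C, hC⟩ := exists_forall_mul_norm_le (freqSubmodule Θ₁.minus).topologicalClosure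
    (fun i : ι => L i.1.2)
    (fun i : ι => i.1.1 ^ t / ‖i.1.2.toLp 2 (volume : Measure Plane)‖)
    (fun i => div_nonneg (Real.rpow_nonneg i.2.1.le _) (norm_nonneg _)) (by
      intro x hx
      obtain ⟨M, hM0, hM⟩ := exists_norm_integral_mul_conj_le Θ₂ t ht
        (hmaps (mem_anisoSpace_of_mem_closure Θ₁ t hx))
      refine ⟨M, ?_⟩
      rintro ⟨⟨R, h⟩, hR, hh⟩
      have h1 := hM R hR h hh
      rw [integral_cutoffOp_mul_conj F hE, ← hL] at h1
      beta_reduce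
      by_cases h0 : ‖h.toLp 2 (volume : Measure Plane)‖ = 0
      · rw [h0, div_zero, zero_mul]
        exact hM0
      · have h0' : 0 < ‖h.toLp 2 (volume : Measure Plane)‖ := (norm_nonneg _).lt_of_ne' h0
        have hRt : 0 < R ^ t := Real.rpow_pos_of_pos hR t
        rw [Real.rpow_neg hR.le] at h1
        calc _ ≤ R ^ t / ‖h.toLp 2‖ * (M * ((R ^ t)⁻¹ * ‖h.toLp 2‖)) := by gcongr
          _ = M := by field_simp)
  refine ⟨C, fun R hR u h hu hh => ?_⟩
  have h1 := hC ⟨(R, h), hR, hh⟩ (u.toLp 2) ((freqSubmodule Θ₁.minus).le_topologicalClosure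
    (mem_freqSubmodule.2 ⟨u, hu, rfl⟩))
  beta_reduce at h1
  by_cases h0 : ‖h.toLp 2 (volume : Measure Plane)‖ = 0
  · rw [h0, eq_zero_of_norm_toLp_eq_zero h0]
    simp
  · have h0' : 0 < ‖h.toLp 2 (volume : Measure Plane)‖ := (norm_nonneg _).lt_of_ne' h0
    have hRt : 0 < R ^ t := Real.rpow_pos_of_pos hR t
    rw [hL, setIntegral_toLp_comp] at h1
    rw [Real.rpow_neg hR.le]
    calc ‖∫ x in E, u (F x) * conj (h x)‖
        = (R ^ t)⁻¹ * ‖h.toLp 2‖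
            * (R ^ t / ‖h.toLp 2‖ * ‖∫ x in E, u (F x) * conj (h x)‖) := by field_simp
      _ ≤ (R ^ t)⁻¹ * ‖h.toLp 2‖ * (C * ‖u.toLp 2‖) := by gcongr
      _ = _ := by ring

/-! ### Conclusion. -/

theorem cutoffOp_not_mapsTo {E : Set Plane} (hE : IsHalfPlane E) (F : Plane ≃L[ℝ] Plane)
    (Θ₁ Θ₂ : ConeSystem) {t : ℝ} (ht : 0 < t) :
    ¬ MapsTo (cutoffOp E (F : Plane →ₗ[ℝ] Plane)) (anisoSpace Θ₁ t) (anisoSpace Θ₂ t) := by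
  intro hmaps
  obtain ⟨w, c, hw, hEw⟩ := hE
  obtain ⟨S, hS, rfl⟩ : ∃ S : Set ℝ, (S = Ici 0 ∨ S = Ioi 0) ∧
      E = {x | inner ℝ w x - c ∈ S} := by
    rcases hEw with h | h
    · exact ⟨Ici 0, Or.inl rfl, by rw [h]; ext; simp⟩
    · exact ⟨Ioi 0, Or.inr rfl, by rw [h]; ext; simp⟩
  have hSm : MeasurableSet S := by
    rcases hS with rfl | rfl <;> measurability
  obtain ⟨C, hC⟩ := exists_pairing_bound_of_mapsTo F
    (((continuous_const.inner continuous_id).sub continuous_const).measurable hSm) ht hmaps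
  exact not_forall_norm_pairing_le Θ₁.isCone_minus Θ₂.isCone_plus Θ₁.interior_minus
    Θ₂.interior_plus F hw hS c ht C hC

theorem ConeSubset.subset {D C : Set Plane} (h : ConeSubset D C) (h0 : (0 : Plane) ∈ C) :
    D ⊆ C := by
  intro x hx
  rcases h (subset_closure hx) with h | h
  · exact interior_subset h
  · rwa [mem_singleton_iff.1 h]

/-- The lines meet only at the origin because the cones do, so they span the plane, and the range of
F contains both. -/
theorem surjective_of_centredOn {Θ : ConeSystem} {Dplus Dminus : Submodule ℝ Plane}
    (hΘ : CentredOn Θ Dplus Dminus) (hDplus : Module.finrank ℝ Dplus = 1)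
    (hDminus : Module.finrank ℝ Dminus = 1) {F : Plane →ₗ[ℝ] Plane}
    (hFplus : Dplus.map F = Dplus) (hFminus : Dminus.map F = Dminus) :
    Function.Surjective F := by
  have h0 : (0 : Plane) ∈ Θ.plus ∩ Θ.minus := by rw [Θ.inter_eq]; rfl
  have hinf : Dplus ⊓ Dminus = ⊥ := by
    rw [eq_bot_iff]
    intro x hx
    have : x ∈ Θ.plus ∩ Θ.minus := ⟨hΘ.1.subset h0.1 hx.1, hΘ.2.subset h0.2 hx.2⟩
    rw [Θ.inter_eq] at this
    exact this
  have hsup : Dplus ⊔ Dminus = ⊤ := by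
    refine Submodule.eq_top_of_finrank_eq ?_
    have := Submodule.finrank_sup_add_finrank_inf_eq Dplus Dminus
    rw [hinf, finrank_bot, hDplus, hDminus] at this
    rw [finrank_euclideanSpace_fin]
    omega
  rw [← LinearMap.range_eq_top, ← Submodule.map_top, ← hsup, Submodule.map_sup, hFplus, hFminus]

end AnisoSobolev

end

theorem propositionA1
    (E : Set AnisoSobolev.Plane) (hE : AnisoSobolev.IsHalfPlane E)
    (Dplus Dminus : Submodule ℝ AnisoSobolev.Plane)
    (hDplus : Module.finrank ℝ Dplus = 1) (hDminus : Module.finrank ℝ Dminus = 1)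
    (F : AnisoSobolev.Plane →ₗ[ℝ] AnisoSobolev.Plane)
    (hFplus : Dplus.map F = Dplus) (hFminus : Dminus.map F = Dminus)
    (Θtilde Θ' : AnisoSobolev.ConeSystem)
    (hΘtilde : AnisoSobolev.CentredOn Θtilde Dplus Dminus)
    (hΘ' : AnisoSobolev.CentredOn Θ' Dplus Dminus)
    (t : ℝ) (ht : 0 < t) :
    ¬ Set.MapsTo (AnisoSobolev.cutoffOp E F)
        (AnisoSobolev.anisoSpace Θtilde (2 * t)) (AnisoSobolev.anisoSpace Θ' (2 * t)) := by
  have hsurj := AnisoSobolev.surjective_of_centredOn hΘtilde hDplus hDminus hFplus hFminus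
  have hinj := LinearMap.injective_iff_surjective.2 hsurj
  exact AnisoSobolev.cutoffOp_not_mapsTo hE
    (LinearEquiv.ofBijective F ⟨hinj, hsurj⟩).toContinuousLinearEquiv Θtilde Θ' (by positivity)
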